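/- Let $\mathbb P(\mathcal H)$ denote the set of positive invertible bounded operators on a complex Hilbert space $\mathcal H$, with the operator order. A (Kubo--Ando) operator mean $\sigma$ assigns to positive operators $A,B$ on a Hilbert space a positive operator $A\,\sigma\,B$ such that: $A\le C$, $B\le D$ imply $A\,\sigma\,B\le C\,\sigma\,D$; $C(A\,\sigma\,B)C\le (CAC)\,\sigma\,(CBC)$ for $C\ge 0$; $A_k\searrow A$, $B_k\searrow B$ (decreasing, strongly convergent sequences) imply $A_k\,\sigma\,B_k\searrow A\,\sigma\,B$; $I\,\sigma\,I=I$. An $n$-variable operator mean $\mathfrak M$ assigns to $A_1,\dots,A_n\in\mathbb P(\mathcal H)$ an element of $\mathbb P(\mathcal H)$ such that: $\mathfrak M$ is monotone in $(A_1,\dots,A_n)$; $S^*\mathfrak M(A_1,\dots,A_n)S=\mathfrak M(S^*A_1S,\dots,S^*A_nS)$ for invertible $S$; if $A_{jk}\nearrow A_j$ for all $j$, or $A_{jk}\searrow A_j$ for all $j$, as $k\to\infty$, in $\mathbb P(\mathcal H)$, then $\mathfrak M(A_{1k},\dots,A_{nk})\to\mathfrak M(A_1,\dots,A_n)$ strongly;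 $\mathfrak M(I,\dots,I)=I$. Such means are understood to be given on all Hilbert spaces, $\sigma$ with the same representing function $f_\sigma$, $f_\sigma(x)I=I\,\sigma\,(xI)$ for $x>0$, on each of them. Let $\sigma$ be an operator mean other than the left trivial mean $A\,\ell\,B=A$. The deformed mean $\mathfrak M_\sigma(A_1,\dots,A_n)$ is the unique $X\in\mathbb P(\mathcal H)$ with $X=\mathfrak M(X\,\sigma\,A_1,\dots,X\,\sigma\,A_n)$. For $h>0$ and $p\in\mathbb R$ let $$K(h,p)=\frac{h^p-h}{(p-1)(h-1)}\left(\frac{p-1}{p}\,\frac{h^p-1}{h^p-h}\right)^p,$$ understood as the limit $1$ if $p\in\{0,1\}$ or $h=1$. For $0<m<M$, $r\in\mathbb R\setminus\{0,1\}$ and $\alpha>0$ put $t_0=\left(\frac{M^r-m^r}{\alpha r(M-m)}\right)^{1/(r-1)}$ and $$\gamma(m,M,r,\alpha)=\begin{cases}\alpha(r-1)\left(\frac{M^r-m^r}{\alpha r(M-m)}\right)^{r/(r-1)}+\frac{Mm^r-mM^r}{M-m}&\text{if } m\le t_0\le M,\\ (1-\alpha)M^r&\text{if } M\le t_0,\\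 (1-\alpha)m^r&\text{if } t_0\le m.\end{cases}$$ **Corollary.** Let $\mathfrak M$ be an $n$-variable operator mean such that, for some probability vector $\omega=(\omega_1,\dots,\omega_n)$, $$\Big(\sum_{j=1}^n\omega_jA_j^{-1}\Big)^{-1}\le\mathfrak M(A_1,\dots,A_n)\le\sum_{j=1}^n\omega_jA_j$$ for all positive invertible $A_1,\dots,A_n$, and let $\sigma\ne\ell$ be an operator mean. Let $\Phi:\mathbb B(\mathcal H)\to\mathbb B(\mathcal K)$ be a unital positive linear map, let $0<m<M$, let $A_1,\dots,A_n\in\mathbb P(\mathcal H)$ satisfy $mI\le A_j\le MI$ for all $j$, and put $h=M/m$. Then for every $r\ge 1$ $$\mathfrak M_\sigma(\Phi(A_1^r),\dots,\Phi(A_n^r))-\Phi(\mathfrak M_\sigma(A_1,\dots,A_n)^r)\le\gamma\!\left(\tfrac1M,\tfrac1m,-r,K(h,r)^{-1}\right)I$$ and $$\left(\frac{(M^r+m^r)^2}{4M^rm^r}\right)^{-1}K(h,-r)^{-1}K(h,r)^{-1}\,\Phi(\mathfrak M_\sigma(A_1,\dots,A_n)^r)\le\mathfrak M_\sigma(\Phi(A_1^r),\dots,\Phi(A_n^r))\le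 K(h,-r)\,K(h,r)\,\Phi(\mathfrak M_\sigma(A_1,\dots,A_n)^r).$$ -/

import Mathlib

open Filter Topology

universe u

/-- Operators `A k` decrease to `L`: `A 0 ≥ A 1 ≥ ⋯` in the operator order and `A k → L` in the
strong operator topology. -/
def DecreasesTo {H : Type u} [NormedAddCommGroup H] [InnerProductSpace ℂ H]
    (A : ℕ → H →L[ℂ] H) (L : H →L[ℂ] H) : Prop :=
  Antitone A ∧ ∀ x : H, Tendsto (fun k => A k x) atTop (𝓝 (L x))

/-- Operators `A k` increase to `L`: `A 0 ≤ A 1 ≤ ⋯` in the operator order and `A k → L` in the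
strong operator topology. -/
def IncreasesTo {H : Type u} [NormedAddCommGroup H] [InnerProductSpace ℂ H]
    (A : ℕ → H →L[ℂ] H) (L : H →L[ℂ] H) : Prop :=
  Monotone A ∧ ∀ x : H, Tendsto (fun k => A k x) atTop (𝓝 (L x))

/-- A two-variable operator mean in the sense of Kubo and Ando, given on every complex Hilbert
space `H`. On each `H` only the values at positive operators matter, and there the four axioms
hold. The last field says that it is one and the same mean on all Hilbert spaces: where
`I σ (x I)` is a multiple `c I` of the identity (as it always is, with `c = f_σ(x)` the
representing function), the number `c` does not depend on the Hilbert space. -/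
structure KuboAndoMean where
  /-- `op H A B` is `A σ B` for operators on `H`. -/
  op : ∀ (H : Type u) [NormedAddCommGroup H] [InnerProductSpace ℂ H] [CompleteSpace H],
    (H →L[ℂ] H) → (H →L[ℂ] H) → (H →L[ℂ] H)
  nonneg : ∀ (H : Type u) [NormedAddCommGroup H] [InnerProductSpace ℂ H] [CompleteSpace H]
    (A B : H →L[ℂ] H), 0 ≤ A → 0 ≤ B → 0 ≤ op H A B
  mono : ∀ (H : Type u) [NormedAddCommGroup H] [InnerProductSpace ℂ H] [CompleteSpace H]
    (A B C D : H →L[ℂ] H), 0 ≤ A → 0 ≤ B → A ≤ C → B ≤ D → op H A B ≤ op H C D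
  transformer : ∀ (H : Type u) [NormedAddCommGroup H] [InnerProductSpace ℂ H] [CompleteSpace H]
    (A B C : H →L[ℂ] H), 0 ≤ A → 0 ≤ B → 0 ≤ C →
      C * op H A B * C ≤ op H (C * A * C) (C * B * C)
  downward_continuous : ∀ (H : Type u) [NormedAddCommGroup H] [InnerProductSpace ℂ H]
    [CompleteSpace H] (A B : ℕ → H →L[ℂ] H) (A' B' : H →L[ℂ] H),
    (∀ k, 0 ≤ A k) → (∀ k, 0 ≤ B k) → 0 ≤ A' → 0 ≤ B' →
    DecreasesTo A A' → DecreasesTo B B' →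
      DecreasesTo (fun k => op H (A k) (B k)) (op H A' B')
  normalized : ∀ (H : Type u) [NormedAddCommGroup H] [InnerProductSpace ℂ H] [CompleteSpace H],
    op H 1 1 = 1
  coherent : ∀ (H K : Type u) [NormedAddCommGroup H] [InnerProductSpace ℂ H] [CompleteSpace H]
    [Nontrivial H] [NormedAddCommGroup K] [InnerProductSpace ℂ K] [CompleteSpace K] (x c : ℝ),
    0 < x → op H 1 (x • (1 : H →L[ℂ] H)) = c • (1 : H →L[ℂ] H) →
      op K 1 (x • (1 : K →L[ℂ] K)) = c • (1 : K →L[ℂ] K)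

/-- `σ` is the left trivial mean `A ℓ B = A`. -/
def KuboAndoMean.IsLeftTrivial (σ : KuboAndoMean.{u}) : Prop :=
  ∀ (H : Type u) [NormedAddCommGroup H] [InnerProductSpace ℂ H] [CompleteSpace H]
    (A B : H →L[ℂ] H), 0 ≤ A → 0 ≤ B → σ.op H A B = A

/-- An `n`-variable operator mean, given on every complex Hilbert space `H`. Only its values at
tuples of positive invertible operators matter. -/
structure OperatorMean (n : ℕ) where
  /-- `mean H A` is `𝔐(A₁, …, Aₙ)` for operators on `H`. -/
  mean : ∀ (H : Type u) [NormedAddCommGroup H] [InnerProductSpace ℂ H] [CompleteSpace H],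
    (Fin n → H →L[ℂ] H) → (H →L[ℂ] H)
  pos : ∀ (H : Type u) [NormedAddCommGroup H] [InnerProductSpace ℂ H] [CompleteSpace H]
    (A : Fin n → H →L[ℂ] H), (∀ j, IsStrictlyPositive (A j)) → IsStrictlyPositive (mean H A)
  mono : ∀ (H : Type u) [NormedAddCommGroup H] [InnerProductSpace ℂ H] [CompleteSpace H]
    (A B : Fin n → H →L[ℂ] H), (∀ j, IsStrictlyPositive (A j)) →
    (∀ j, IsStrictlyPositive (B j)) → (∀ j, A j ≤ B j) → mean H A ≤ mean H B
  congruence : ∀ (H : Type u) [NormedAddCommGroup H] [InnerProductSpace ℂ H] [CompleteSpace H]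
    (A : Fin n → H →L[ℂ] H) (S : H →L[ℂ] H), (∀ j, IsStrictlyPositive (A j)) → IsUnit S →
      star S * mean H A * S = mean H (fun j => star S * A j * S)
  monotone_continuous : ∀ (H : Type u) [NormedAddCommGroup H] [InnerProductSpace ℂ H]
    [CompleteSpace H] (A : Fin n → H →L[ℂ] H) (B : Fin n → ℕ → H →L[ℂ] H),
    (∀ j, IsStrictlyPositive (A j)) → (∀ j k, IsStrictlyPositive (B j k)) →
    ((∀ j, IncreasesTo (B j) (A j)) ∨ (∀ j, DecreasesTo (B j) (A j))) →
      ∀ x : H, Tendsto (fun k => mean H (fun j => B j k) x) atTop (𝓝 (mean H A x))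
  normalized : ∀ (H : Type u) [NormedAddCommGroup H] [InnerProductSpace ℂ H] [CompleteSpace H],
    mean H (fun _ => 1) = 1

/-- The weighted arithmetic mean `∑ ωⱼ Aⱼ`. -/
noncomputable def arithMean {H : Type u} [NormedAddCommGroup H] [InnerProductSpace ℂ H]
    {n : ℕ} (ω : Fin n → ℝ) (A : Fin n → H →L[ℂ] H) : H →L[ℂ] H :=
  ∑ j, ω j • A j

/-- The weighted harmonic mean `(∑ ωⱼ Aⱼ⁻¹)⁻¹`, for invertible `Aⱼ`. -/
noncomputable def harmMean {H : Type u} [NormedAddCommGroup H] [InnerProductSpace ℂ H]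
    {n : ℕ} (ω : Fin n → ℝ) (A : Fin n → H →L[ℂ] H) : H →L[ℂ] H :=
  Ring.inverse (∑ j, ω j • Ring.inverse (A j))

open Classical in
/-- The deformed mean `𝔐_σ(A₁, …, Aₙ)`: the positive invertible solution `X` of
`X = 𝔐(X σ A₁, …, X σ Aₙ)`. For positive invertible `Aⱼ` and `σ` not the left trivial mean there
is exactly one; the value `0` is used only if there is none. -/
noncomputable def deformedMean {n : ℕ} (𝔐 : OperatorMean.{u} n) (σ : KuboAndoMean.{u})
    {H : Type u} [NormedAddCommGroup H] [InnerProductSpace ℂ H] [CompleteSpace H]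
    (A : Fin n → H →L[ℂ] H) : H →L[ℂ] H :=
  if h : ∃ X : H →L[ℂ] H, IsStrictlyPositive X ∧ X = 𝔐.mean H (fun j => σ.op H X (A j))
  then h.choose else 0

/-- The generalized Kantorovich constant `K(h, p)`, for `h > 0`. The formula is `0 / 0` at `p = 0`,
`p = 1` and `h = 1`, where the constant is the limit `1`. -/
noncomputable def kantorovich (h p : ℝ) : ℝ :=
  if p = 0 ∨ p = 1 ∨ h = 1 then 1
  else (h ^ p - h) / ((p - 1) * (h - 1)) * ((p - 1) / p * ((h ^ p - 1) / (h ^ p - h))) ^ p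

/-- The point `((M^r - m^r) / (α r (M - m)))^(1/(r-1))`. -/
noncomputable def gammaPoint (m M r α : ℝ) : ℝ :=
  ((M ^ r - m ^ r) / (α * r * (M - m))) ^ (1 / (r - 1))

/-- The constant `γ(m, M, r, α)`, for `0 < m < M`, `r ≠ 0, 1` and `α > 0`. -/
noncomputable def gammaConst (m M r α : ℝ) : ℝ :=
  if m ≤ gammaPoint m M r α ∧ gammaPoint m M r α ≤ M then
    α * (r - 1) * ((M ^ r - m ^ r) / (α * r * (M - m))) ^ (r / (r - 1))
      + (M * m ^ r - m * M ^ r) / (M - m)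
  else if M ≤ gammaPoint m M r α then (1 - α) * M ^ r
  else (1 - α) * m ^ r

/-! Write X for the deformed mean of the A_j and Y for that of the Φ(A_j^r). Deformation preserves
the harmonic–arithmetic bounds with the same weights: X ≤ ∑ ω_j A_j and X⁻¹ ≤ ∑ ω_j A_j⁻¹
(`deformedMean_bounds`), and likewise for Y. Indeed σ itself obeys such bounds with one weight α > 0
(`exists_weight`); inserted into X = 𝔐(X σ A_j) they give X ≤ (1 - α) X + α ∑ ω_j A_j, and X
cancels. Here α is a common supergradient at 1 of the concave functions f_σ(x) and 1 / f_σ(1/y), and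
α = 0 would make σ left trivial.

The rest is the Mond–Pečarić method. A convex power lies below its chord on the spectral interval,
and chords, being affine, commute with weighted averages. The chord of t^(-r) on [1/M, 1/m] has
negative slope, so ∑ ω_j A_j^r is at most that chord at X⁻¹, hence at most K(h,-r) X^r, or α X^r + γ
for any α > 0. The chord of t^r on [m, M] gives X^r ≤ K(h,r) ∑ ω_j A_j^r.

Applying Φ and Y ≤ ∑ ω_j Φ(A_j^r) yields the upper bounds. The lower bound also uses the exponent 1
case for the operators Φ(A_j^r), with constant K(h^r,-1) = (M^r + m^r)² / (4 M^r m^r). The remaining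
Kantorovich factors are slack, since K ≥ 1. -/

open scoped InnerProductSpace

/-! ### Operator order, quadratic forms and strong limits -/

section OperatorOrder

variable {H : Type u} [NormedAddCommGroup H] [InnerProductSpace ℂ H]

lemma ContinuousLinearMap.re_inner_le_of_le {S T : H →L[ℂ] H} (h : S ≤ T) (x : H) :
    (⟪S x, x⟫_ℂ).re ≤ (⟪T x, x⟫_ℂ).re := by
  have := ((ContinuousLinearMap.le_def S T).1 h).re_inner_nonneg_left x
  simpa [inner_sub_left] using this

lemma ContinuousLinearMap.re_inner_nonneg {T : H →L[ℂ] H} (h : 0 ≤ T) (x : H) :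
    0 ≤ (⟪T x, x⟫_ℂ).re := by
  simpa using ContinuousLinearMap.re_inner_le_of_le h x

lemma re_inner_real_smul (c : ℝ) (x y : H) : (⟪(c • x : H), y⟫_ℂ).re = c * (⟪x, y⟫_ℂ).re := by
  rw [← Complex.coe_smul, inner_smul_left]; simp

variable [CompleteSpace H]

lemma IsSelfAdjoint.real_smul {T : H →L[ℂ] H} (hT : IsSelfAdjoint T) (c : ℝ) :
    IsSelfAdjoint (c • T) := by
  rw [ContinuousLinearMap.isSelfAdjoint_iff_isSymmetric] at hT ⊢
  intro x y
  have := hT x y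
  simp only [ContinuousLinearMap.coe_coe, smul_apply] at this ⊢
  rw [← Complex.coe_smul, ← Complex.coe_smul, inner_smul_left, inner_smul_right, this,
    Complex.conj_ofReal]

lemma ContinuousLinearMap.le_of_forall_re_inner_le {S T : H →L[ℂ] H} (hS : IsSelfAdjoint S)
    (hT : IsSelfAdjoint T) (h : ∀ x : H, (⟪S x, x⟫_ℂ).re ≤ (⟪T x, x⟫_ℂ).re) : S ≤ T := by
  rw [ContinuousLinearMap.le_def, ContinuousLinearMap.isPositive_def']
  refine ⟨hT.sub hS, fun x => ?_⟩
  simpa [ContinuousLinearMap.reApplyInnerSelf, inner_sub_left] using h x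

lemma ContinuousLinearMap.le_of_forall_unit_re_inner_le {S T : H →L[ℂ] H}
    (hS : IsSelfAdjoint S) (hT : IsSelfAdjoint T)
    (h : ∀ x : H, ‖x‖ = 1 → (⟪S x, x⟫_ℂ).re ≤ (⟪T x, x⟫_ℂ).re) : S ≤ T := by
  refine ContinuousLinearMap.le_of_forall_re_inner_le hS hT fun x => ?_
  rcases eq_or_ne x 0 with rfl | hx
  · simp
  have hn : 0 < ‖x‖ := norm_pos_iff.2 hx
  set y : H := ((‖x‖⁻¹ : ℝ) : ℂ) • x with hy
  have hy1 : ‖y‖ = 1 := by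
    rw [hy, norm_smul]; simp [hn.ne']
  have hxy : x = ((‖x‖ : ℝ) : ℂ) • y := by
    rw [hy, smul_smul, ← Complex.ofReal_mul, mul_inv_cancel₀ hn.ne']; simp
  have key : ∀ R : H →L[ℂ] H, (⟪R x, x⟫_ℂ).re = ‖x‖ ^ 2 * (⟪R y, y⟫_ℂ).re := by
    intro R
    conv_lhs => rw [hxy]
    rw [map_smul, inner_smul_left, inner_smul_right, Complex.conj_ofReal, ← mul_assoc,
      ← Complex.ofReal_mul, Complex.re_ofReal_mul, sq]
  rw [key, key]
  exact mul_le_mul_of_nonneg_left (h y hy1) (by positivity)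

lemma isStrictlyPositive_of_smul_one_le {T : H →L[ℂ] H} {c : ℝ} (hc : 0 < c)
    (h : c • (1 : H →L[ℂ] H) ≤ T) : IsStrictlyPositive T :=
  IsStrictlyPositive.of_le (IsStrictlyPositive.smul hc isStrictlyPositive_one) h

lemma isStrictlyPositive_smul_one {c : ℝ} (hc : 0 < c) :
    IsStrictlyPositive (c • (1 : H →L[ℂ] H)) :=
  IsStrictlyPositive.smul hc isStrictlyPositive_one

lemma IsStrictlyPositive.exists_smul_one_le {T : H →L[ℂ] H} (h : IsStrictlyPositive T) :
    ∃ c : ℝ, 0 < c ∧ c • (1 : H →L[ℂ] H) ≤ T := by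
  rcases subsingleton_or_nontrivial (H →L[ℂ] H) with hs | hs
  · exact ⟨1, one_pos, le_of_eq (Subsingleton.elim _ _)⟩
  · obtain ⟨c, hc, hle⟩ := (CFC.exists_pos_algebraMap_le_iff h.isSelfAdjoint).2
      fun x hx => h.spectrum_pos hx
    exact ⟨c, hc, by rwa [← Algebra.algebraMap_eq_smul_one]⟩

/-- Cauchy–Schwarz for the form `⟪T x, y⟫` of a positive operator. -/
lemma ContinuousLinearMap.norm_inner_sq_le_of_nonneg {T : H →L[ℂ] H} (h : 0 ≤ T) (x y : H) :
    ‖⟪T x, y⟫_ℂ‖ ^ 2 ≤ (⟪T x, x⟫_ℂ).re * (⟪T y, y⟫_ℂ).re := by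
  have hS : IsSelfAdjoint (CFC.sqrt T) := (CFC.sqrt_nonneg T).isSelfAdjoint
  have key : ∀ u v : H, ⟪T u, v⟫_ℂ = ⟪CFC.sqrt T u, CFC.sqrt T v⟫_ℂ := by
    intro u v
    conv_lhs => rw [← CFC.sqrt_mul_sqrt_self T h]
    rw [mul_apply_eq_comp, ← ContinuousLinearMap.adjoint_inner_right,
      ← ContinuousLinearMap.star_eq_adjoint, hS.star_eq]
  rw [key x x, key y y, key x y]
  have h1 := norm_inner_le_norm (𝕜 := ℂ) (CFC.sqrt T x) (CFC.sqrt T y)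
  have h2 : ∀ z : H, (⟪z, z⟫_ℂ).re = ‖z‖ ^ 2 := fun z => by
    simpa using inner_self_eq_norm_sq (𝕜 := ℂ) z
  rw [h2, h2, ← mul_pow]
  gcongr

/-- A decreasing sequence of positive operators converges strongly. -/
lemma exists_decreasesTo {A : ℕ → H →L[ℂ] H} (hA : Antitone A) (h0 : ∀ k, 0 ≤ A k) :
    ∃ L : H →L[ℂ] H, DecreasesTo A L := by
  have hconv : ∀ x : H, ∃ y, Tendsto (fun k => A k x) atTop (𝓝 y) := by
    intro x
    have hq : Antitone fun k => (⟪A k x, x⟫_ℂ).re :=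
      fun i j hij => ContinuousLinearMap.re_inner_le_of_le (hA hij) x
    have hqb : BddBelow (Set.range fun k => (⟪A k x, x⟫_ℂ).re) :=
      ⟨0, by rintro _ ⟨k, rfl⟩; exact ContinuousLinearMap.re_inner_nonneg (h0 k) x⟩
    have hqc : CauchySeq fun k => (⟪A k x, x⟫_ℂ).re := (tendsto_atTop_ciInf hq hqb).cauchySeq
    -- Cauchy–Schwarz for D = A i - A j, with D x as second vector, and ‖D‖ ≤ ‖A 0‖ control the
    -- vectors A k x by their convergent quadratic forms.
    have hest : ∀ i j, i ≤ j → ‖A i x - A j x‖ ^ 2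
        ≤ ‖A 0‖ * ((⟪A i x, x⟫_ℂ).re - (⟪A j x, x⟫_ℂ).re) := by
      intro i j hij
      set D := A i - A j with hD
      have hD0 : 0 ≤ D := sub_nonneg.2 (hA hij)
      have hDn : ‖D‖ ≤ ‖A 0‖ := CStarAlgebra.norm_le_norm_of_nonneg_of_le hD0
        ((sub_le_self _ (h0 j)).trans (hA (Nat.zero_le i)))
      have hDx : D x = A i x - A j x := rfl
      have hinner : (⟪D x, x⟫_ℂ).re = (⟪A i x, x⟫_ℂ).re - (⟪A j x, x⟫_ℂ).re := by
        simp [hDx]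
      rw [← hinner, ← hDx]
      have hx0 : 0 ≤ (⟪D x, x⟫_ℂ).re := ContinuousLinearMap.re_inner_nonneg hD0 x
      have hcs := ContinuousLinearMap.norm_inner_sq_le_of_nonneg hD0 x (D x)
      have h1 : ‖⟪D x, D x⟫_ℂ‖ = ‖D x‖ ^ 2 := by
        rw [inner_self_eq_norm_sq_to_K]; simp
      have h2 : (⟪D (D x), D x⟫_ℂ).re ≤ ‖A 0‖ * ‖D x‖ ^ 2 := by
        calc (⟪D (D x), D x⟫_ℂ).re ≤ ‖⟪D (D x), D x⟫_ℂ‖ := Complex.re_le_norm _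
          _ ≤ ‖D (D x)‖ * ‖D x‖ := norm_inner_le_norm _ _
          _ ≤ (‖D‖ * ‖D x‖) * ‖D x‖ := by gcongr; exact D.le_opNorm _
          _ ≤ (‖A 0‖ * ‖D x‖) * ‖D x‖ := by gcongr
          _ = ‖A 0‖ * ‖D x‖ ^ 2 := by ring
      rw [h1] at hcs
      rcases (norm_nonneg (D x)).eq_or_lt with h3 | h3
      · rw [← h3]; simpa using mul_nonneg (norm_nonneg (A 0)) hx0
      · have h4 : ‖D x‖ ^ 2 * ‖D x‖ ^ 2 ≤ (‖A 0‖ * (⟪D x, x⟫_ℂ).re) * ‖D x‖ ^ 2 := by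
          nlinarith [mul_le_mul_of_nonneg_left h2 hx0]
        exact le_of_mul_le_mul_right h4 (by positivity)
    refine cauchySeq_tendsto_of_complete (Metric.cauchySeq_iff'.2 fun ε hε => ?_)
    obtain ⟨N, hN⟩ := Metric.cauchySeq_iff'.1 hqc (ε ^ 2 / (‖A 0‖ + 1)) (by positivity)
    refine ⟨N, fun k hk => ?_⟩
    have h1 := hest N k hk
    have h2 := hN k hk
    rw [Real.dist_eq, abs_sub_comm] at h2
    have h3 := (le_abs_self _).trans_lt h2
    rw [dist_comm, dist_eq_norm]
    refine lt_of_pow_lt_pow_left₀ 2 hε.le (h1.trans_lt ?_)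
    rw [lt_div_iff₀ (by positivity)] at h3
    have h4 : 0 ≤ (⟪A N x, x⟫_ℂ).re - (⟪A k x, x⟫_ℂ).re := sub_nonneg.2 (hq hk)
    rcases h4.eq_or_lt with h5 | h5
    · rw [← h5]; simpa using pow_pos hε 2
    · nlinarith
  choose f hf using hconv
  exact ⟨continuousLinearMapOfTendsto (σ₁₂ := RingHom.id ℂ) A (tendsto_pi_nhds.2 hf), hA, hf⟩

lemma DecreasesTo.smul_one_le {A : ℕ → H →L[ℂ] H} {L : H →L[ℂ] H} (h : DecreasesTo A L)
    {c : ℝ} (hc : ∀ k, c • (1 : H →L[ℂ] H) ≤ A k) : c • (1 : H →L[ℂ] H) ≤ L := by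
  have hsa : IsSelfAdjoint (c • (1 : H →L[ℂ] H)) := IsSelfAdjoint.real_smul (.one _) c
  have hA : ∀ k, IsSelfAdjoint (A k) := fun k => by
    have := (sub_nonneg.2 (hc k)).isSelfAdjoint.add hsa
    rwa [sub_add_cancel] at this
  have hL : IsSelfAdjoint L := by
    rw [ContinuousLinearMap.isSelfAdjoint_iff_isSymmetric]
    intro x y
    refine tendsto_nhds_unique ((h.2 x).inner tendsto_const_nhds)
      ((tendsto_const_nhds.inner (h.2 y)).congr fun k => ?_)
    exact ((ContinuousLinearMap.isSelfAdjoint_iff_isSymmetric.1 (hA k)) x y).symm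
  refine ContinuousLinearMap.le_of_forall_re_inner_le hsa hL fun x => ?_
  exact ge_of_tendsto' ((Complex.continuous_re.tendsto _).comp
    ((h.2 x).inner tendsto_const_nhds)) fun k => ContinuousLinearMap.re_inner_le_of_le (hc k) x

omit [CompleteSpace H] in
lemma DecreasesTo.unique {A : ℕ → H →L[ℂ] H} {L L' : H →L[ℂ] H} (h : DecreasesTo A L)
    (h' : ∀ x, Tendsto (fun k => A k x) atTop (𝓝 (L' x))) : L = L' :=
  ContinuousLinearMap.ext fun x => tendsto_nhds_unique (h.2 x) (h' x)

omit [CompleteSpace H] in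
lemma apply_ringInverse_apply {T : H →L[ℂ] H} (h : IsStrictlyPositive T) (x : H) :
    T (Ring.inverse T x) = x := by
  rw [← mul_apply_eq_comp, Ring.mul_inverse_cancel _ h.isUnit]; rfl

omit [CompleteSpace H] in
lemma rankOne_mul_mul_rankOne (T : H →L[ℂ] H) (x : H) :
    InnerProductSpace.rankOne ℂ x x * T * InnerProductSpace.rankOne ℂ x x
      = ⟪x, T x⟫_ℂ • InnerProductSpace.rankOne ℂ x x := by
  ext y
  simp [smul_smul, mul_comm]

omit [CompleteSpace H] in
lemma re_inner_smul_rankOne (c : ℝ) (x y : H) :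
    (⟪(c • InnerProductSpace.rankOne ℂ x x) y, y⟫_ℂ).re = c * ‖⟪x, y⟫_ℂ‖ ^ 2 := by
  rw [smul_apply, re_inner_real_smul, InnerProductSpace.rankOne_apply,
    inner_smul_left, inner_conj_symm, ← inner_conj_symm y x, ← Complex.normSq_eq_conj_mul_self,
    Complex.ofReal_re, Complex.normSq_eq_norm_sq]

/-- The largest multiple of a rank-one operator below a strictly positive operator. -/
lemma smul_rankOne_le {T : H →L[ℂ] H} (h : IsStrictlyPositive T) {x : H} {c : ℝ} (hc : 0 ≤ c)
    (hcx : c * (⟪Ring.inverse T x, x⟫_ℂ).re ≤ 1) :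
    c • InnerProductSpace.rankOne ℂ x x ≤ T := by
  have hP : IsSelfAdjoint (InnerProductSpace.rankOne ℂ x x) :=
    (InnerProductSpace.isPositive_rankOne_self x).isSelfAdjoint
  refine ContinuousLinearMap.le_of_forall_re_inner_le
    (hP.real_smul c) h.isSelfAdjoint fun y => ?_
  have hcs := ContinuousLinearMap.norm_inner_sq_le_of_nonneg h.nonneg (Ring.inverse T x) y
  rw [apply_ringInverse_apply h] at hcs
  have h1 : (⟪x, Ring.inverse T x⟫_ℂ).re = (⟪Ring.inverse T x, x⟫_ℂ).re := by
    simpa using inner_re_symm (𝕜 := ℂ) x (Ring.inverse T x)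
  have hy := ContinuousLinearMap.re_inner_nonneg h.nonneg y
  rw [re_inner_smul_rankOne]
  rw [h1] at hcs
  nlinarith [mul_le_mul_of_nonneg_left hcs hc, mul_le_mul_of_nonneg_right hcx hy]

/-- Converse of `smul_rankOne_le`: test the quadratic forms at T⁻¹ x. -/
lemma mul_inner_ringInverse_le_one {T : H →L[ℂ] H} (h : IsStrictlyPositive T) {x : H} {c : ℝ}
    (hle : c • InnerProductSpace.rankOne ℂ x x ≤ T) :
    c * (⟪Ring.inverse T x, x⟫_ℂ).re ≤ 1 := by
  set y := Ring.inverse T x with hy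
  have h1 := ContinuousLinearMap.re_inner_le_of_le hle y
  have hTy : T y = x := apply_ringInverse_apply h x
  have hq : 0 ≤ (⟪y, x⟫_ℂ).re := ContinuousLinearMap.re_inner_nonneg h.ringInverse.nonneg x
  have h3 : (⟪x, y⟫_ℂ).re = (⟪y, x⟫_ℂ).re := by simpa using inner_re_symm (𝕜 := ℂ) x y
  have h4 : (⟪y, x⟫_ℂ).re ^ 2 ≤ ‖⟪x, y⟫_ℂ‖ ^ 2 := by
    rw [← h3, ← sq_abs]
    gcongr
    exact Complex.abs_re_le_norm _
  rw [hTy, re_inner_smul_rankOne, h3] at h1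
  rcases le_or_gt c 0 with hc | hc
  · exact (mul_nonpos_of_nonpos_of_nonneg hc hq).trans zero_le_one
  rcases hq.eq_or_lt with h5 | h5
  · rw [← h5]; simp
  · nlinarith [mul_le_mul_of_nonneg_left h4 hc.le]

end OperatorOrder

lemma Ring.inverse_eq_of_mul_eq_one {R : Type*} [Ring R] {a b : R} (h : a * b = 1)
    (h' : b * a = 1) : Ring.inverse a = b :=
  Ring.inverse_unit ⟨a, b, h, h'⟩

/-! ### Kubo–Ando means: congruence and compression by projections -/

namespace KuboAndoMean

variable (σ : KuboAndoMean.{u}) {H : Type u} [NormedAddCommGroup H] [InnerProductSpace ℂ H]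
  [CompleteSpace H]

/-- The transformer inequality is an equality for strictly positive operators. -/
lemma transformer_eq {A B C : H →L[ℂ] H} (hA : 0 ≤ A) (hB : 0 ≤ B) (hC : IsStrictlyPositive C) :
    C * σ.op H A B * C = σ.op H (C * A * C) (C * B * C) := by
  refine le_antisymm (σ.transformer H A B C hA hB hC.nonneg) ?_
  have hR := hC.ringInverse
  set R := Ring.inverse C with hRdef
  have h1 : R * C = 1 := Ring.inverse_mul_cancel _ hC.isUnit
  have h2 : C * R = 1 := Ring.mul_inverse_cancel _ hC.isUnit
  -- The transformer inequality for C⁻¹, conjugated back by C, is the reverse inequality.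
  have h := σ.transformer H (C * A * C) (C * B * C) R
    (conjugate_nonneg_of_nonneg hA hC.nonneg) (conjugate_nonneg_of_nonneg hB hC.nonneg) hR.nonneg
  have h3 : ∀ D : H →L[ℂ] H, R * (C * D * C) * R = D := fun D => by
    rw [show R * (C * D * C) * R = (R * C) * D * (C * R) by noncomm_ring, h1, h2, one_mul, mul_one]
  have h4 : ∀ D : H →L[ℂ] H, C * (R * D * R) * C = D := fun D => by
    rw [show C * (R * D * R) * C = (C * R) * D * (R * C) by noncomm_ring, h1, h2, one_mul, mul_one]
  rw [h3, h3] at h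
  have h5 := conjugate_le_conjugate_of_nonneg h hC.nonneg
  rwa [h4] at h5

lemma op_smul_one_self {c : ℝ} (hc : 0 < c) :
    σ.op H (c • (1 : H →L[ℂ] H)) (c • (1 : H →L[ℂ] H)) = c • (1 : H →L[ℂ] H) := by
  have h := σ.transformer_eq (H := H) zero_le_one zero_le_one
    (isStrictlyPositive_smul_one (H := H) (Real.sqrt_pos.2 hc))
  have h1 : (√c • (1 : H →L[ℂ] H)) * 1 * (√c • (1 : H →L[ℂ] H)) = c • (1 : H →L[ℂ] H) := by
    rw [mul_one, smul_mul_smul_comm, mul_one, Real.mul_self_sqrt hc.le]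
  rw [σ.normalized, h1] at h
  exact h.symm

lemma smul_one_le_op {A B : H →L[ℂ] H} {c : ℝ} (hc : 0 < c) (hA : c • (1 : H →L[ℂ] H) ≤ A)
    (hB : c • (1 : H →L[ℂ] H) ≤ B) : c • (1 : H →L[ℂ] H) ≤ σ.op H A B := by
  have h0 := (isStrictlyPositive_smul_one (H := H) hc).nonneg
  have := σ.mono H _ _ _ _ h0 h0 hA hB
  rwa [σ.op_smul_one_self hc] at this

lemma op_le_smul_one {A B : H →L[ℂ] H} {c : ℝ} (hc : 0 < c) (hA0 : 0 ≤ A) (hB0 : 0 ≤ B)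
    (hA : A ≤ c • (1 : H →L[ℂ] H)) (hB : B ≤ c • (1 : H →L[ℂ] H)) :
    σ.op H A B ≤ c • (1 : H →L[ℂ] H) := by
  have := σ.mono H _ _ _ _ hA0 hB0 hA hB
  rwa [σ.op_smul_one_self hc] at this

lemma isStrictlyPositive_op {A B : H →L[ℂ] H} (hA : IsStrictlyPositive A)
    (hB : IsStrictlyPositive B) : IsStrictlyPositive (σ.op H A B) := by
  obtain ⟨a, ha, haA⟩ := hA.exists_smul_one_le
  obtain ⟨b, hb, hbB⟩ := hB.exists_smul_one_le
  have hm : 0 < min a b := lt_min ha hb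
  refine isStrictlyPositive_of_smul_one_le hm (σ.smul_one_le_op hm (le_trans ?_ haA)
    (le_trans ?_ hbB))
  · exact smul_le_smul_of_nonneg_right (min_le_left a b) zero_le_one
  · exact smul_le_smul_of_nonneg_right (min_le_right a b) zero_le_one

section Projection

variable {P A B : H →L[ℂ] H}

/-- A projection is not invertible, so the transformer inequality need not be an equality. For D ≥ 0
commuting with P one has D - P D P = (1 - P) D (1 - P) ≥ 0, and monotonicity then supplies a bound
on the other side. -/
lemma conjugate_le_op_conjugate_le (hP : IsStarProjection P) (hA : 0 ≤ A) (hB : 0 ≤ B)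
    (hPA : Commute P A) (hPB : Commute P B) :
    P * σ.op H A B * P ≤ σ.op H (P * A * P) (P * B * P) ∧
      σ.op H (P * A * P) (P * B * P) ≤ σ.op H A B := by
  have key : ∀ D : H →L[ℂ] H, 0 ≤ D → Commute P D → P * D * P ≤ D := by
    intro D hD hPD
    have hQ := hP.one_sub
    have h : 0 ≤ (1 - P) * D * (1 - P) := conjugate_nonneg_of_nonneg hD hQ.nonneg
    have e : (1 - P) * D * (1 - P) = D - P * D * P := by
      have h1 : P * D * P = P * D := by
        rw [mul_assoc, ← hPD.eq, ← mul_assoc, hP.isIdempotentElem.eq]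
      have h2 : D * P = P * D := hPD.eq.symm
      rw [h1, sub_mul, one_mul, mul_sub, mul_one, sub_mul, h1, h2, sub_self, sub_zero]
    rw [e] at h
    exact sub_nonneg.1 h
  exact ⟨σ.transformer H A B P hA hB hP.nonneg,
    σ.mono H _ _ _ _ (conjugate_nonneg_of_nonneg hA hP.nonneg)
      (conjugate_nonneg_of_nonneg hB hP.nonneg) (key A hA hPA) (key B hB hPB)⟩

/-- The difference D = T - P T P is positive with P D P = 0, so √D P = 0 and therefore D P = 0. -/
lemma op_mul_projection (hP : IsStarProjection P) (hA : 0 ≤ A) (hB : 0 ≤ B)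
    (hPA : Commute P A) (hPB : Commute P B) :
    σ.op H A B * P = P * σ.op H A B * P := by
  obtain ⟨h1, h2⟩ := σ.conjugate_le_op_conjugate_le hP hA hB hPA hPB
  set T := σ.op H A B with hT
  have hPP := hP.isIdempotentElem.eq
  have hD : 0 ≤ T - P * T * P := sub_nonneg.2 (h1.trans h2)
  set D := T - P * T * P with hDdef
  have hPDP : P * D * P = 0 := by
    rw [hDdef, mul_sub, sub_mul, show P * (P * T * P) * P = (P * P) * T * (P * P) by noncomm_ring,
      hPP, sub_self]
  have hS : IsSelfAdjoint (CFC.sqrt D) := (CFC.sqrt_nonneg D).isSelfAdjoint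
  have hSP : CFC.sqrt D * P = 0 := by
    rw [← CStarRing.star_mul_self_eq_zero_iff, star_mul, hS.star_eq, hP.isSelfAdjoint.star_eq,
      show P * CFC.sqrt D * (CFC.sqrt D * P) = P * (CFC.sqrt D * CFC.sqrt D) * P by noncomm_ring,
      CFC.sqrt_mul_sqrt_self D hD, hPDP]
  have hDP : D * P = 0 := by
    rw [← CFC.sqrt_mul_sqrt_self D hD, mul_assoc, hSP, mul_zero]
  rw [hDdef, sub_mul, mul_assoc (P * T), hPP] at hDP
  exact sub_eq_zero.1 hDP

end Projection

/-! ### The representing function and its Jensen inequalities -/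

section ReprFun

instance : Nontrivial (EuclideanSpace ℂ PUnit.{u + 1}) :=
  ⟨EuclideanSpace.single PUnit.unit 1, 0, by simp⟩

lemma eq_smul_one_of_nonneg_line
    {T : EuclideanSpace ℂ PUnit.{u + 1} →L[ℂ] EuclideanSpace ℂ PUnit.{u + 1}}
    (hT : 0 ≤ T) : ∃ c : ℝ, T = c • (1 : EuclideanSpace ℂ PUnit.{u + 1} →L[ℂ] _) := by
  set e : EuclideanSpace ℂ PUnit.{u + 1} := EuclideanSpace.single PUnit.unit 1 with he
  have hy : ∀ y : EuclideanSpace ℂ PUnit.{u + 1}, y = y PUnit.unit • e := by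
    intro y; ext ⟨⟩; simp [he]
  have hreal : ((T e PUnit.unit).re : ℂ) = T e PUnit.unit := by
    have h := ((ContinuousLinearMap.nonneg_iff_isPositive T).1 hT).inner_nonneg_right e
    have h2 : ⟪e, T e⟫_ℂ = T e PUnit.unit := by simp [he, EuclideanSpace.inner_single_left]
    rw [h2] at h
    exact Complex.ext rfl (Complex.le_def.1 h).2
  refine ⟨(T e PUnit.unit).re, ContinuousLinearMap.ext fun y => ?_⟩
  rw [hy y, map_smul, map_smul]
  congr 1
  rw [smul_apply, ← Complex.coe_smul, hreal]
  exact hy (T e)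

/-- On a one-dimensional space every positive operator is a real scalar; `coherent` carries that
scalar to all Hilbert spaces. -/
lemma exists_reprFun : ∃ f : ℝ → ℝ, ∀ x : ℝ, 0 < x → ∀ (K : Type u) [NormedAddCommGroup K]
    [InnerProductSpace ℂ K] [CompleteSpace K],
    σ.op K 1 (x • (1 : K →L[ℂ] K)) = f x • (1 : K →L[ℂ] K) := by
  have h : ∀ x : ℝ, ∃ c : ℝ, 0 < x → ∀ (K : Type u) [NormedAddCommGroup K]
      [InnerProductSpace ℂ K] [CompleteSpace K],
      σ.op K 1 (x • (1 : K →L[ℂ] K)) = c • (1 : K →L[ℂ] K) := by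
    intro x
    by_cases hx : 0 < x
    · obtain ⟨c, hc⟩ := eq_smul_one_of_nonneg_line
        (σ.nonneg (EuclideanSpace ℂ PUnit.{u + 1}) 1 (x • 1) zero_le_one
          (isStrictlyPositive_smul_one hx).nonneg)
      exact ⟨c, fun _ K _ _ _ => σ.coherent (EuclideanSpace ℂ PUnit.{u + 1}) K x c hx hc⟩
    · exact ⟨0, fun h => absurd h hx⟩
  choose f hf using h
  exact ⟨f, hf⟩

/-- The representing function `f` of a mean: `I σ (x I) = f(x) I` for `x > 0`. -/
noncomputable def reprFun : ℝ → ℝ := σ.exists_reprFun.choose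

lemma op_one_smul_one {x : ℝ} (hx : 0 < x) :
    σ.op H 1 (x • (1 : H →L[ℂ] H)) = σ.reprFun x • (1 : H →L[ℂ] H) :=
  σ.exists_reprFun.choose_spec x hx H

omit [CompleteSpace H] in
lemma le_of_smul_one_le_smul_one [Nontrivial H] {a b : ℝ}
    (h : a • (1 : H →L[ℂ] H) ≤ b • (1 : H →L[ℂ] H)) : a ≤ b := by
  obtain ⟨x, hx⟩ := exists_ne (0 : H)
  have h1 := ContinuousLinearMap.re_inner_le_of_le h x
  simp only [smul_apply, re_inner_real_smul] at h1
  have h2 : 0 < (⟪(1 : H →L[ℂ] H) x, x⟫_ℂ).re := by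
    have : (⟪(1 : H →L[ℂ] H) x, x⟫_ℂ).re = ‖x‖ ^ 2 := by
      simpa using inner_self_eq_norm_sq (𝕜 := ℂ) x
    rw [this]
    positivity
  exact le_of_mul_le_mul_right h1 h2

lemma min_le_reprFun {x : ℝ} (hx : 0 < x) : min 1 x ≤ σ.reprFun x := by
  have h := σ.smul_one_le_op (H := EuclideanSpace ℂ PUnit.{u + 1}) (A := 1) (B := x • 1)
    (lt_min one_pos hx) ?_ ?_
  · rw [σ.op_one_smul_one hx] at h
    exact le_of_smul_one_le_smul_one h
  · conv_rhs => rw [← one_smul ℝ (1 : EuclideanSpace ℂ PUnit.{u + 1} →L[ℂ] _)]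
    exact smul_le_smul_of_nonneg_right (min_le_left 1 x) zero_le_one
  · exact smul_le_smul_of_nonneg_right (min_le_right 1 x) zero_le_one

lemma reprFun_pos {x : ℝ} (hx : 0 < x) : 0 < σ.reprFun x :=
  (lt_min one_pos hx).trans_le (σ.min_le_reprFun hx)

lemma reprFun_one : σ.reprFun 1 = 1 := by
  have h := σ.op_one_smul_one (H := EuclideanSpace ℂ PUnit.{u + 1}) one_pos
  rw [one_smul, σ.normalized] at h
  have h' : (1 : ℝ) • (1 : EuclideanSpace ℂ PUnit.{u + 1} →L[ℂ] EuclideanSpace ℂ PUnit.{u + 1})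
      = σ.reprFun 1 • 1 := by
    rw [one_smul]; exact h
  exact le_antisymm (le_of_smul_one_le_smul_one h'.ge) (le_of_smul_one_le_smul_one h'.le)

lemma op_projection_smul {P : H →L[ℂ] H} (hP : IsStarProjection P) {x : ℝ} (hx : 0 < x) :
    P * σ.op H P (x • P) * P = σ.reprFun x • P ∧ σ.reprFun x • P ≤ σ.op H P (x • P) := by
  have hPP := hP.isIdempotentElem.eq
  obtain ⟨h1, h2⟩ := σ.conjugate_le_op_conjugate_le hP (A := 1) (B := x • 1) zero_le_one
    (isStrictlyPositive_smul_one hx).nonneg (Commute.one_right P)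
    ((Commute.one_right P).smul_right x)
  have e : ∀ c : ℝ, P * (c • (1 : H →L[ℂ] H)) * P = c • P := fun c => by
    rw [mul_smul_comm, mul_one, smul_mul_assoc, hPP]
  rw [σ.op_one_smul_one hx, e, e, mul_one, hPP] at h1
  rw [σ.op_one_smul_one hx, e, mul_one, hPP] at h2
  refine ⟨le_antisymm ?_ ?_, h1⟩
  · have := conjugate_le_conjugate_of_nonneg h2 hP.nonneg
    rwa [e] at this
  · have := conjugate_le_conjugate_of_nonneg h1 hP.nonneg
    rwa [mul_smul_comm, hPP, smul_mul_assoc, hPP] at this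

/-- The map A ↦ I σ A acts on eigenspaces as f does on eigenvalues. This replaces the full identity
I σ A = f(A): operators with two eigenvalues are enough for concavity. -/
lemma op_one_mul_projection {P A : H →L[ℂ] H} (hP : IsStarProjection P) (hA : 0 ≤ A)
    {a : ℝ} (ha : 0 < a) (hPA : P * A = a • P) (hAP : A * P = a • P) :
    σ.op H 1 A * P = σ.reprFun a • P := by
  have hPP := hP.isIdempotentElem.eq
  have hc : Commute P A := hPA.trans hAP.symm
  have e : P * A * P = a • P := by rw [hPA, smul_mul_assoc, hPP]
  rw [σ.op_mul_projection hP zero_le_one hA (Commute.one_right P) hc]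
  obtain ⟨h1, h2⟩ := σ.conjugate_le_op_conjugate_le hP zero_le_one hA (Commute.one_right P) hc
  rw [e, mul_one, hPP] at h1 h2
  have h3 := conjugate_le_conjugate_of_nonneg h1 hP.nonneg
  have h4 := conjugate_le_conjugate_of_nonneg h2 hP.nonneg
  rw [(σ.op_projection_smul hP ha).1] at h3 h4
  rw [show P * (P * σ.op H 1 A * P) * P = (P * P) * σ.op H 1 A * (P * P) by noncomm_ring, hPP] at h3
  exact le_antisymm h3 h4

lemma op_one_diagonal {P : H →L[ℂ] H} (hP : IsStarProjection P) {a b : ℝ} (ha : 0 < a)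
    (hb : 0 < b) : σ.op H 1 (a • P + b • (1 - P))
      = σ.reprFun a • P + σ.reprFun b • (1 - P) := by
  have hPP := hP.isIdempotentElem.eq
  have hQ := hP.one_sub
  have hQQ := hQ.isIdempotentElem.eq
  have hPQ : P * (1 - P) = 0 := hP.mul_one_sub_self
  have hQP : (1 - P) * P = 0 := hP.one_sub_mul_self
  have hA : 0 ≤ a • P + b • (1 - P) :=
    add_nonneg (smul_nonneg ha.le hP.nonneg) (smul_nonneg hb.le hQ.nonneg)
  have h1 := σ.op_one_mul_projection hP hA ha (by simp [mul_add, hPP, hPQ])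
    (by simp [add_mul, hPP, hQP])
  have h2 := σ.op_one_mul_projection hQ hA hb
    (by simp only [mul_add, mul_smul_comm, hQP, hQQ, smul_zero, zero_add])
    (by simp only [add_mul, smul_mul_assoc, hPQ, hQQ, smul_zero, zero_add])
  rw [← h1, ← h2, ← mul_add, add_sub_cancel, mul_one]

/-- Jensen's inequality for `A ↦ I σ A`. -/
lemma re_inner_op_one_le {A : H →L[ℂ] H} (hA : IsStrictlyPositive A) {ξ : H} (hξ : ‖ξ‖ = 1) :
    0 < (⟪A ξ, ξ⟫_ℂ).re ∧ (⟪σ.op H 1 A ξ, ξ⟫_ℂ).re ≤ σ.reprFun (⟪A ξ, ξ⟫_ℂ).re := by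
  have hP : IsStarProjection (InnerProductSpace.rankOne ℂ ξ ξ) :=
    InnerProductSpace.isStarProjection_rankOne_self hξ
  set P := InnerProductSpace.rankOne ℂ ξ ξ with hPdef
  have hPP := hP.isIdempotentElem.eq
  have hξξ : ⟪ξ, ξ⟫_ℂ = 1 := by rw [inner_self_eq_norm_sq_to_K, hξ]; simp
  have hpos : 0 < (⟪A ξ, ξ⟫_ℂ).re := by
    obtain ⟨c, hc, hcA⟩ := hA.exists_smul_one_le
    have := ContinuousLinearMap.re_inner_le_of_le hcA ξ
    rw [smul_apply, re_inner_real_smul, show (1 : H →L[ℂ] H) ξ = ξ from rfl, hξξ] at this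
    simp at this
    linarith
  refine ⟨hpos, ?_⟩
  have hcompr : ∀ D : H →L[ℂ] H, 0 ≤ D → P * D * P = (⟪D ξ, ξ⟫_ℂ).re • P := by
    intro D hD
    rw [hPdef, rankOne_mul_mul_rankOne, ← Complex.coe_smul]
    congr 1
    have h := ((ContinuousLinearMap.nonneg_iff_isPositive D).1 hD)
    rw [← h.inner_left_eq_inner_right]
    exact Complex.ext rfl (Complex.le_def.1 (h.inner_nonneg_left ξ)).2.symm
  -- Compression to the line of ξ turns A into its expectation value, and the compressed mean into f
  -- of that value.
  have h1 := σ.transformer H 1 A P zero_le_one hA.nonneg hP.nonneg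
  rw [mul_one, hPP, hcompr A hA.nonneg, hcompr _ (σ.nonneg H 1 A zero_le_one hA.nonneg)] at h1
  have h2 := conjugate_le_conjugate_of_nonneg h1 hP.nonneg
  rw [(σ.op_projection_smul hP hpos).1, mul_smul_comm, hPP, smul_mul_assoc, hPP] at h2
  have h3 := ContinuousLinearMap.re_inner_le_of_le h2 ξ
  rw [hPdef, re_inner_smul_rankOne, re_inner_smul_rankOne, hξξ] at h3
  simpa using h3

/-- Jensen's inequality for `A ↦ (I σ A⁻¹)⁻¹`. -/
lemma re_inner_ringInverse_op_one_le {A : H →L[ℂ] H} (hA : IsStrictlyPositive A) {ξ : H}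
    (hξ : ‖ξ‖ = 1) : 0 < (⟪Ring.inverse A ξ, ξ⟫_ℂ).re ∧
      (⟪Ring.inverse (σ.op H 1 A) ξ, ξ⟫_ℂ).re
        ≤ (σ.reprFun (⟪Ring.inverse A ξ, ξ⟫_ℂ).re⁻¹)⁻¹ := by
  have hP : IsStarProjection (InnerProductSpace.rankOne ℂ ξ ξ) :=
    InnerProductSpace.isStarProjection_rankOne_self hξ
  have hpos := (σ.re_inner_op_one_le hA.ringInverse hξ).1
  refine ⟨hpos, ?_⟩
  -- This multiple c P of the projection is the largest below A. Monotonicity gives f(c) P ≤ P σ (c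
  -- P) ≤ I σ A, and the rank-one bound is then read backwards for (I σ A)⁻¹.
  have hle : (⟪Ring.inverse A ξ, ξ⟫_ℂ).re⁻¹ • InnerProductSpace.rankOne ℂ ξ ξ ≤ A :=
    smul_rankOne_le hA (inv_pos.2 hpos).le (inv_mul_cancel₀ hpos.ne').le
  have h1 := (σ.op_projection_smul hP (inv_pos.2 hpos)).2.trans
    (σ.mono H _ _ _ _ hP.nonneg (smul_nonneg (inv_pos.2 hpos).le hP.nonneg) hP.le_one hle)
  have h2 := mul_inner_ringInverse_le_one (σ.isStrictlyPositive_op isStrictlyPositive_one hA) h1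
  rwa [mul_comm, ← le_div_iff₀ (σ.reprFun_pos (inv_pos.2 hpos)), one_div] at h2

lemma ringInverse_diagonal {P : H →L[ℂ] H} (hP : IsStarProjection P) {a b : ℝ} (ha : 0 < a)
    (hb : 0 < b) : Ring.inverse (a • P + b • (1 - P)) = a⁻¹ • P + b⁻¹ • (1 - P) := by
  have hPP := hP.isIdempotentElem.eq
  have hQQ := hP.one_sub.isIdempotentElem.eq
  have hPQ : P * (1 - P) = 0 := hP.mul_one_sub_self
  have hQP : (1 - P) * P = 0 := hP.one_sub_mul_self
  apply Ring.inverse_eq_of_mul_eq_one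
  · simp only [add_mul, mul_add, smul_mul_smul_comm, hPP, hQQ, hPQ, hQP, mul_inv_cancel₀ ha.ne',
      mul_inv_cancel₀ hb.ne', smul_zero, one_smul, add_zero, zero_add, add_sub_cancel]
  · simp only [add_mul, mul_add, smul_mul_smul_comm, hPP, hQQ, hPQ, hQP, inv_mul_cancel₀ ha.ne',
      inv_mul_cancel₀ hb.ne', smul_zero, one_smul, add_zero, zero_add, add_sub_cancel]

lemma isStrictlyPositive_diagonal {P : H →L[ℂ] H} (hP : IsStarProjection P) {a b : ℝ}
    (ha : 0 < a) (hb : 0 < b) : IsStrictlyPositive (a • P + b • (1 - P)) := by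
  refine isStrictlyPositive_of_smul_one_le (lt_min ha hb) ?_
  have h : min a b • (1 : H →L[ℂ] H) = min a b • P + min a b • (1 - P) := by
    rw [← smul_add, add_sub_cancel]
  rw [h]
  exact add_le_add (smul_le_smul_of_nonneg_right (min_le_left a b) hP.nonneg)
    (smul_le_smul_of_nonneg_right (min_le_right a b) hP.one_sub.nonneg)

/-- A projection on a two-dimensional space takes every expectation value in `[0, 1]`. -/
lemma exists_projection_expectation {l k : ℝ} (hl : 0 ≤ l) (hk : 0 ≤ k) (hlk : l + k = 1) :
    ∃ (P : EuclideanSpace ℂ (ULift.{u} (Fin 2)) →L[ℂ] EuclideanSpace ℂ (ULift.{u} (Fin 2)))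
      (ξ : EuclideanSpace ℂ (ULift.{u} (Fin 2))), IsStarProjection P ∧ ‖ξ‖ = 1 ∧
      ∀ a b : ℝ, (⟪(a • P + b • (1 - P)) ξ, ξ⟫_ℂ).re = l * a + k * b := by
  set e : EuclideanSpace ℂ (ULift.{u} (Fin 2)) := EuclideanSpace.single ⟨0⟩ 1 with he
  set g : EuclideanSpace ℂ (ULift.{u} (Fin 2)) := EuclideanSpace.single ⟨1⟩ 1 with hg
  have hee : ‖e‖ = 1 := by simp [he]
  have hgg : ‖g‖ = 1 := by simp [hg]
  have heg : ⟪e, g⟫_ℂ = 0 := by simp [he, hg, EuclideanSpace.inner_single_left]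
  have hge : ⟪g, e⟫_ℂ = 0 := by simp [he, hg, EuclideanSpace.inner_single_left]
  have hee' : ⟪e, e⟫_ℂ = 1 := by rw [inner_self_eq_norm_sq_to_K, hee]; simp
  have hgg' : ⟪g, g⟫_ℂ = 1 := by rw [inner_self_eq_norm_sq_to_K, hgg]; simp
  have hl2 : (√l : ℂ) * √l = l := by rw [← Complex.ofReal_mul, Real.mul_self_sqrt hl]
  have hk2 : (√k : ℂ) * √k = k := by rw [← Complex.ofReal_mul, Real.mul_self_sqrt hk]
  set ξ := (√l : ℂ) • e + (√k : ℂ) • g with hξ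
  have hin : ⟪ξ, ξ⟫_ℂ = 1 := by
    simp only [hξ, inner_add_left, inner_add_right, inner_smul_left, inner_smul_right, hee', hgg',
      heg, hge, Complex.conj_ofReal, mul_one, mul_zero, add_zero, zero_add, hl2, hk2]
    rw [← Complex.ofReal_add, hlk, Complex.ofReal_one]
  have heξ : ⟪e, ξ⟫_ℂ = √l := by
    rw [hξ, inner_add_right, inner_smul_right, inner_smul_right, hee', heg]; simp
  refine ⟨InnerProductSpace.rankOne ℂ e e, ξ, InnerProductSpace.isStarProjection_rankOne_self hee,
    ?_, fun a b => ?_⟩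
  · have := inner_self_eq_norm_sq (𝕜 := ℂ) ξ
    rw [hin] at this
    exact (pow_eq_one_iff_of_nonneg (norm_nonneg ξ) two_ne_zero).1 (by simpa using this.symm)
  · have h : a • InnerProductSpace.rankOne ℂ e e + b • (1 - InnerProductSpace.rankOne ℂ e e)
        = (a - b) • InnerProductSpace.rankOne ℂ e e + b • (1 : _ →L[ℂ] _) := by
      rw [smul_sub, sub_smul]; abel
    rw [h, add_apply, inner_add_left, Complex.add_re, re_inner_smul_rankOne, smul_apply,
      re_inner_real_smul, show (1 : EuclideanSpace ℂ (ULift.{u} (Fin 2)) →L[ℂ] _) ξ = ξ from rfl,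
      hin, heξ, Complex.norm_real, Real.norm_eq_abs, sq_abs, Real.sq_sqrt hl, Complex.one_re,
      show k = 1 - l by linarith]
    ring

/-- Jensen's inequality for an operator with eigenvalues a and b, in a unit vector giving them
probabilities l and k. -/
lemma concaveOn_reprFun : ConcaveOn ℝ (Set.Ioi 0) σ.reprFun := by
  refine ⟨convex_Ioi 0, fun a (ha : 0 < a) b (hb : 0 < b) l k hl hk hlk => ?_⟩
  obtain ⟨P, ξ, hP, hξ, h⟩ := exists_projection_expectation.{u} hl hk hlk
  have h1 := (σ.re_inner_op_one_le (isStrictlyPositive_diagonal hP ha hb) hξ).2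
  rw [σ.op_one_diagonal hP ha hb, h, h] at h1
  simpa using h1

lemma concaveOn_inv_reprFun_inv : ConcaveOn ℝ (Set.Ioi 0) fun y => (σ.reprFun y⁻¹)⁻¹ := by
  refine ⟨convex_Ioi 0, fun a (ha : 0 < a) b (hb : 0 < b) l k hl hk hlk => ?_⟩
  obtain ⟨P, ξ, hP, hξ, h⟩ := exists_projection_expectation.{u} hl hk hlk
  have ha' := inv_pos.2 ha
  have hb' := inv_pos.2 hb
  have h1 := (σ.re_inner_ringInverse_op_one_le (isStrictlyPositive_diagonal hP ha' hb') hξ).2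
  rw [σ.op_one_diagonal hP ha' hb', ringInverse_diagonal hP ha' hb',
    ringInverse_diagonal hP (σ.reprFun_pos ha') (σ.reprFun_pos hb'), h, h, inv_inv, inv_inv] at h1
  simpa using h1

end ReprFun

/-! ### The weight of a mean and its harmonic–arithmetic bounds -/

section Weight

lemma exists_supergradient {f : ℝ → ℝ} (hf : ConcaveOn ℝ (Set.Ioi 0) f) (hf1 : f 1 = 1) :
    ∃ α : ℝ, ∀ x, 0 < x → f x ≤ 1 + α * (x - 1) := by
  have h1 : (1 : ℝ) ∈ interior (Set.Ioi (0 : ℝ)) := by simp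
  have hg := hf.neg
  refine ⟨-derivWithin (-f) (Set.Ioi 1) 1, fun x hx => ?_⟩
  rcases lt_trichotomy x 1 with h | rfl | h
  · have h2 := (hg.slope_le_leftDeriv_of_mem_interior hx h1 h).trans
      (hg.leftDeriv_le_rightDeriv_of_mem_interior h1)
    rw [slope_def_field, Pi.neg_apply, Pi.neg_apply, hf1, div_le_iff₀ (by linarith)] at h2
    linarith
  · simp [hf1]
  · have h2 := hg.rightDeriv_le_slope_of_mem_interior h1 (Set.mem_Ioi.2 hx) h
    rw [slope_def_field, Pi.neg_apply, Pi.neg_apply, hf1, le_div_iff₀ (by linarith)] at h2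
    linarith

/-- Both concave functions equal 1 at 1, so each has a supergradient there, α and β. Their values at
reciprocal points are reciprocal, which forces α = β without any differentiability of f. -/
lemma exists_reprFun_le : ∃ α : ℝ, 0 ≤ α ∧ (∀ x, 0 < x → σ.reprFun x ≤ 1 + α * (x - 1)) ∧
    ∀ y, 0 < y → (σ.reprFun y⁻¹)⁻¹ ≤ 1 + α * (y - 1) := by
  obtain ⟨α, hα⟩ := exists_supergradient σ.concaveOn_reprFun σ.reprFun_one
  obtain ⟨β, hβ⟩ := exists_supergradient σ.concaveOn_inv_reprFun_inv
    (by rw [inv_one, σ.reprFun_one, inv_one])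
  have hα0 : 0 ≤ α := by
    have h := (σ.min_le_reprFun two_pos).trans (hα 2 two_pos)
    norm_num at h
    exact h
  -- Expansion of 1 + u ≤ f(1 + u) (1 + u - β u) ≤ (1 + α u) (1 + u - β u).
  have key : ∀ u : ℝ, -1 < u → 0 ≤ (α - β) * u + α * (1 - β) * u ^ 2 := by
    intro u hu
    have hx : 0 < 1 + u := by linarith
    have h1 := hα (1 + u) hx
    have h2 := hβ (1 + u)⁻¹ (inv_pos.2 hx)
    have hp := σ.reprFun_pos hx
    rw [inv_inv] at h2
    have h3 : (1 + u) ≤ σ.reprFun (1 + u) * (1 + u - β * u) := by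
      have h4 := mul_le_mul_of_nonneg_left h2 (mul_pos hp hx).le
      field_simp at h4
      linarith
    have h5 : 0 ≤ 1 + u - β * u := by
      by_contra hneg
      push Not at hneg
      nlinarith [mul_pos hp (neg_pos.2 hneg)]
    nlinarith [mul_le_mul_of_nonneg_right h1 h5]
  have hαβ : α = β := by
    by_contra hne
    set c := α * (1 - β) with hc
    set d := α - β with hd
    have hd0 : d ≠ 0 := sub_ne_zero.2 hne
    have hpos : 0 < 1 + |c| + |d| := by positivity
    -- A small u of sign opposite to d: the linear term d u is negative and outweighs c u².
    have hu : -1 < -d / (2 * (1 + |c| + |d|)) := by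
      rw [lt_div_iff₀ (by positivity)]
      nlinarith [le_abs_self d, abs_nonneg c, abs_nonneg d]
    have h := key _ hu
    have h1 : d * (-d / (2 * (1 + |c| + |d|))) + c * (-d / (2 * (1 + |c| + |d|))) ^ 2
        = d ^ 2 * (c - 2 * (1 + |c| + |d|)) / (2 * (1 + |c| + |d|)) ^ 2 := by
      field_simp
      ring
    rw [h1] at h
    have h2 : d ^ 2 * (c - 2 * (1 + |c| + |d|)) / (2 * (1 + |c| + |d|)) ^ 2 < 0 := by
      apply div_neg_of_neg_of_pos _ (by positivity)
      apply mul_neg_of_pos_of_neg (by positivity)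
      nlinarith [le_abs_self c, abs_nonneg c, abs_nonneg d]
    linarith
  subst hαβ
  exact ⟨α, hα0, hα, hβ⟩

/-- For A = I, combine the two Jensen inequalities with the supergradient bounds in each unit
vector. Congruence by √A reduces the general case to this one. The sign of 1 - α plays no role. -/
lemma op_le_and_ringInverse_op_le {α : ℝ}
    (h1 : ∀ x, 0 < x → σ.reprFun x ≤ 1 + α * (x - 1))
    (h2 : ∀ y, 0 < y → (σ.reprFun y⁻¹)⁻¹ ≤ 1 + α * (y - 1))
    {A B : H →L[ℂ] H} (hA : IsStrictlyPositive A) (hB : IsStrictlyPositive B) :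
    σ.op H A B ≤ (1 - α) • A + α • B ∧
      Ring.inverse (σ.op H A B) ≤ (1 - α) • Ring.inverse A + α • Ring.inverse B := by
  have hval : ∀ (D : H →L[ℂ] H) (ξ : H), ‖ξ‖ = 1 →
      (⟪((1 - α) • (1 : H →L[ℂ] H) + α • D) ξ, ξ⟫_ℂ).re = 1 + α * ((⟪D ξ, ξ⟫_ℂ).re - 1) := by
    intro D ξ hξ
    have hξξ : ⟪ξ, ξ⟫_ℂ = 1 := by rw [inner_self_eq_norm_sq_to_K, hξ]; simp
    rw [add_apply, inner_add_left, Complex.add_re, smul_apply, smul_apply, re_inner_real_smul,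
      re_inner_real_smul, show (1 : H →L[ℂ] H) ξ = ξ from rfl, hξξ, Complex.one_re]
    ring
  have hsa : ∀ D : H →L[ℂ] H, IsStrictlyPositive D →
      IsSelfAdjoint ((1 - α) • (1 : H →L[ℂ] H) + α • D) := fun D hD =>
    (IsSelfAdjoint.real_smul (.one _) _).add (hD.isSelfAdjoint.real_smul α)
  have base : ∀ D : H →L[ℂ] H, IsStrictlyPositive D →
      σ.op H 1 D ≤ (1 - α) • (1 : H →L[ℂ] H) + α • D ∧
      Ring.inverse (σ.op H 1 D) ≤ (1 - α) • (1 : H →L[ℂ] H) + α • Ring.inverse D := by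
    intro D hD
    have hT := σ.isStrictlyPositive_op isStrictlyPositive_one hD
    refine ⟨ContinuousLinearMap.le_of_forall_unit_re_inner_le hT.isSelfAdjoint (hsa D hD)
      fun ξ hξ => ?_, ContinuousLinearMap.le_of_forall_unit_re_inner_le
        hT.ringInverse.isSelfAdjoint (hsa _ hD.ringInverse) fun ξ hξ => ?_⟩
    · obtain ⟨h3, h4⟩ := σ.re_inner_op_one_le hD hξ
      rw [hval D ξ hξ]
      exact h4.trans (h1 _ h3)
    · obtain ⟨h3, h4⟩ := σ.re_inner_ringInverse_op_one_le hD hξ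
      rw [hval _ ξ hξ]
      exact h4.trans (h2 _ h3)
  have hD : IsStrictlyPositive (CFC.conjSqrt (Ring.inverse A) B) :=
    (CFC.isStrictlyPositive_conjSqrt_iff _ _ hA.ringInverse).2 hB
  set D := CFC.conjSqrt (Ring.inverse A) B with hDdef
  have hAD : CFC.conjSqrt A D = B := CFC.conjSqrt_conjSqrt_ringInverse A B hA
  have hop : σ.op H A B = CFC.conjSqrt A (σ.op H 1 D) := by
    have h := σ.transformer_eq zero_le_one hD.nonneg hA.sqrt
    rw [← CFC.conjSqrt_apply, ← CFC.conjSqrt_apply, ← CFC.conjSqrt_apply,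
      CFC.conjSqrt_one A hA.nonneg, hAD] at h
    exact h.symm
  have hinvD : Ring.inverse D = CFC.conjSqrt A (Ring.inverse B) := by
    rw [hDdef, CFC.ringInverse_conjSqrt _ _ hA.ringInverse, Ring.inverse_inverse hA.isUnit]
  obtain ⟨h3, h4⟩ := base D hD
  refine ⟨?_, ?_⟩
  · have h := CFC.conjSqrt_le_conjSqrt (c := A) h3
    rwa [← hop, map_add, map_smul, map_smul, CFC.conjSqrt_one A hA.nonneg, hAD] at h
  · have h := CFC.conjSqrt_le_conjSqrt (c := Ring.inverse A) h4
    rwa [map_add, map_smul, map_smul, CFC.conjSqrt_one _ hA.ringInverse.nonneg, hinvD,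
      CFC.conjSqrt_ringInverse_conjSqrt A _ hA, ← CFC.ringInverse_conjSqrt A _ hA, ← hop] at h

lemma decreasesTo_add_inv_smul_one {A : H →L[ℂ] H} :
    DecreasesTo (fun k : ℕ => A + ((k : ℝ) + 1)⁻¹ • (1 : H →L[ℂ] H)) A := by
  refine ⟨fun i j hij => ?_, fun x => ?_⟩
  · have : ((j : ℝ) + 1)⁻¹ ≤ ((i : ℝ) + 1)⁻¹ := by gcongr
    exact add_le_add_right (smul_le_smul_of_nonneg_right this zero_le_one) A
  · have h : Tendsto (fun k : ℕ => ((k : ℝ) + 1)⁻¹) atTop (𝓝 0) := by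
      simpa using tendsto_one_div_add_atTop_nhds_zero_nat (𝕜 := ℝ)
    simpa using tendsto_const_nhds.add (h.smul_const x)

/-- If the derivative of the representing function vanishes at `1`, the mean is left trivial. -/
lemma isLeftTrivial_of_reprFun_le (h1 : ∀ x, 0 < x → σ.reprFun x ≤ 1)
    (h2 : ∀ y, 0 < y → (σ.reprFun y⁻¹)⁻¹ ≤ 1) : σ.IsLeftTrivial := by
  have hsp : ∀ (H : Type u) [NormedAddCommGroup H] [InnerProductSpace ℂ H] [CompleteSpace H]
      (A B : H →L[ℂ] H), IsStrictlyPositive A → IsStrictlyPositive B → σ.op H A B = A := by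
    intro H _ _ _ A B hA hB
    obtain ⟨h3, h4⟩ := σ.op_le_and_ringInverse_op_le (α := 0) (by simpa using h1)
      (by simpa using h2) hA hB
    rw [sub_zero, one_smul, zero_smul, add_zero] at h3 h4
    have hT := σ.isStrictlyPositive_op hA hB
    have h5 := CStarAlgebra.ringInverse_le_ringInverse h4 hT.ringInverse
    rw [Ring.inverse_inverse hT.isUnit, Ring.inverse_inverse hA.isUnit] at h5
    exact le_antisymm h3 h5
  intro H _ _ _ A B hA hB
  -- Positive operators that may fail to be invertible are reached by downward continuity from D + I
  -- / (k + 1).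
  have hpos : ∀ (D : H →L[ℂ] H), 0 ≤ D → ∀ k : ℕ,
      IsStrictlyPositive (D + ((k : ℝ) + 1)⁻¹ • (1 : H →L[ℂ] H)) := fun D hD k =>
    IsStrictlyPositive.nonneg_add hD (isStrictlyPositive_smul_one (by positivity))
  have h := σ.downward_continuous H _ _ A B (fun k => (hpos A hA k).nonneg)
    (fun k => (hpos B hB k).nonneg) hA hB decreasesTo_add_inv_smul_one decreasesTo_add_inv_smul_one
  refine h.unique fun x => ?_
  refine (decreasesTo_add_inv_smul_one (A := A)).2 x |>.congr fun k => ?_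
  rw [hsp H _ _ (hpos A hA k) (hpos B hB k)]

/-- A mean other than the left trivial one lies between the weighted harmonic and the weighted
arithmetic mean, for some positive weight of the second variable. -/
lemma exists_weight (hσ : ¬ σ.IsLeftTrivial) : ∃ α : ℝ, 0 < α ∧
    ∀ (H : Type u) [NormedAddCommGroup H] [InnerProductSpace ℂ H] [CompleteSpace H]
      (A B : H →L[ℂ] H), IsStrictlyPositive A → IsStrictlyPositive B →
      σ.op H A B ≤ (1 - α) • A + α • B ∧
        Ring.inverse (σ.op H A B) ≤ (1 - α) • Ring.inverse A + α • Ring.inverse B := by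
  obtain ⟨α, hα0, h1, h2⟩ := σ.exists_reprFun_le
  rcases hα0.eq_or_lt with rfl | hα
  · exact absurd (σ.isLeftTrivial_of_reprFun_le (by simpa using h1) (by simpa using h2)) hσ
  · exact ⟨α, hα, fun H _ _ _ A B hA hB => σ.op_le_and_ringInverse_op_le h1 h2 hA hB⟩

end Weight

end KuboAndoMean

/-! ### The deformed mean as a fixed point, and its bounds -/

section Deformed

variable {n : ℕ} (𝔐 : OperatorMean.{u} n) (σ : KuboAndoMean.{u})
  {H : Type u} [NormedAddCommGroup H] [InnerProductSpace ℂ H] [CompleteSpace H]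

lemma OperatorMean.mean_smul_one {c : ℝ} (hc : 0 < c) :
    𝔐.mean H (fun _ => c • (1 : H →L[ℂ] H)) = c • (1 : H →L[ℂ] H) := by
  have hS := isStrictlyPositive_smul_one (H := H) (Real.sqrt_pos.2 hc)
  have h := 𝔐.congruence H (fun _ => 1) (√c • (1 : H →L[ℂ] H)) (fun _ => isStrictlyPositive_one)
    hS.isUnit
  have h1 : (√c • (1 : H →L[ℂ] H)) * 1 * (√c • (1 : H →L[ℂ] H)) = c • (1 : H →L[ℂ] H) := by
    rw [mul_one, smul_mul_smul_comm, mul_one, Real.mul_self_sqrt hc.le]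
  rw [hS.isSelfAdjoint.star_eq, 𝔐.normalized, h1] at h
  exact h.symm

/-- Existence of the deformed mean, by monotone iteration. -/
lemma exists_deformedMean {A : Fin n → H →L[ℂ] H} {m M : ℝ} (hm : 0 < m) (hmM : m ≤ M)
    (hAm : ∀ j, m • (1 : H →L[ℂ] H) ≤ A j) (hAM : ∀ j, A j ≤ M • (1 : H →L[ℂ] H)) :
    ∃ X : H →L[ℂ] H, IsStrictlyPositive X ∧ X = 𝔐.mean H (fun j => σ.op H X (A j)) := by
  have hM : 0 < M := hm.trans_le hmM
  have hA : ∀ j, IsStrictlyPositive (A j) := fun j => isStrictlyPositive_of_smul_one_le hm (hAm j)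
  set F : (H →L[ℂ] H) → (H →L[ℂ] H) := fun X => 𝔐.mean H (fun j => σ.op H X (A j)) with hF
  have hmono : ∀ X Y : H →L[ℂ] H, IsStrictlyPositive X → X ≤ Y → F X ≤ F Y := by
    intro X Y hX hXY
    have hY := hX.of_le hXY
    exact 𝔐.mono H _ _ (fun j => σ.isStrictlyPositive_op hX (hA j))
      (fun j => σ.isStrictlyPositive_op hY (hA j))
      fun j => σ.mono H _ _ _ _ hX.nonneg (hA j).nonneg hXY le_rfl
  have hlow : ∀ X : H →L[ℂ] H, m • (1 : H →L[ℂ] H) ≤ X → m • (1 : H →L[ℂ] H) ≤ F X := by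
    intro X hX
    rw [← 𝔐.mean_smul_one (H := H) hm]
    exact 𝔐.mono H _ _ (fun _ => isStrictlyPositive_smul_one hm)
      (fun j => σ.isStrictlyPositive_op (isStrictlyPositive_of_smul_one_le hm hX) (hA j))
      fun j => σ.smul_one_le_op hm hX (hAm j)
  -- The iteration starts at M I, where F(M I) ≤ M I, so it decreases; it stays above m I. Both
  -- means are continuous along such decreasing sequences, so the limit is a fixed point.
  set X : ℕ → H →L[ℂ] H := fun k => F^[k] (M • 1) with hXdef
  have hsucc : ∀ k, X (k + 1) = F (X k) := fun k => Function.iterate_succ_apply' F k _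
  have hXm : ∀ k, m • (1 : H →L[ℂ] H) ≤ X k := by
    intro k
    induction k with
    | zero => exact smul_le_smul_of_nonneg_right hmM zero_le_one
    | succ k ih => rw [hsucc]; exact hlow _ ih
  have hXsp : ∀ k, IsStrictlyPositive (X k) := fun k =>
    isStrictlyPositive_of_smul_one_le hm (hXm k)
  have hanti : Antitone X := by
    refine antitone_nat_of_succ_le fun k => ?_
    induction k with
    | zero =>
      rw [hsucc]
      change F (M • (1 : H →L[ℂ] H)) ≤ M • (1 : H →L[ℂ] H)
      conv_rhs => rw [← 𝔐.mean_smul_one (H := H) hM]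
      have hMsp := isStrictlyPositive_smul_one (H := H) hM
      exact 𝔐.mono H _ _ (fun j => σ.isStrictlyPositive_op hMsp (hA j)) (fun _ => hMsp)
        fun j => σ.op_le_smul_one hM hMsp.nonneg (hA j).nonneg le_rfl (hAM j)
    | succ k ih =>
      have := hmono _ _ (hXsp (k + 1)) ih
      rwa [← hsucc, ← hsucc] at this
  obtain ⟨L, hL⟩ := exists_decreasesTo hanti fun k => (hXsp k).nonneg
  have hLsp : IsStrictlyPositive L := isStrictlyPositive_of_smul_one_le hm (hL.smul_one_le hXm)
  refine ⟨L, hLsp, ContinuousLinearMap.ext fun x => ?_⟩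
  have hop : ∀ j, DecreasesTo (fun k => σ.op H (X k) (A j)) (σ.op H L (A j)) := fun j =>
    σ.downward_continuous H X (fun _ => A j) L (A j) (fun k => (hXsp k).nonneg)
      (fun _ => (hA j).nonneg) hLsp.nonneg (hA j).nonneg hL
      ⟨antitone_const, fun _ => tendsto_const_nhds⟩
  have h := 𝔐.monotone_continuous H (fun j => σ.op H L (A j)) (fun j k => σ.op H (X k) (A j))
    (fun j => σ.isStrictlyPositive_op hLsp (hA j))
    (fun j k => σ.isStrictlyPositive_op (hXsp k) (hA j)) (Or.inr hop) x
  refine tendsto_nhds_unique ((tendsto_add_atTop_iff_nat 1).2 (hL.2 x)) (h.congr fun k => ?_)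
  rw [hsucc]

lemma sum_smul_strictlyPositive {ω : Fin n → ℝ} (hω : ∀ j, 0 ≤ ω j) (hω_sum : ∑ j, ω j = 1)
    {A : Fin n → H →L[ℂ] H} (hA : ∀ j, IsStrictlyPositive (A j)) :
    IsStrictlyPositive (∑ j, ω j • A j) := by
  obtain ⟨i, hi⟩ : ∃ i, 0 < ω i := by
    by_contra! h
    have := Finset.sum_nonpos (s := Finset.univ) fun j _ => h j
    linarith
  rw [← Finset.add_sum_erase _ _ (Finset.mem_univ i)]
  exact IsStrictlyPositive.add_nonneg (IsStrictlyPositive.smul hi (hA i))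
    (Finset.sum_nonneg fun j _ => smul_nonneg (hω j) (hA j).nonneg)

/-- The bounds hold for every positive invertible solution, so uniqueness of the deformed mean is
not used. -/
lemma le_and_ringInverse_le_of_fixedPoint (hσ : ¬ σ.IsLeftTrivial) {ω : Fin n → ℝ}
    (hω : ∀ j, 0 ≤ ω j) (hω_sum : ∑ j, ω j = 1)
    (h𝔐 : ∀ B : Fin n → H →L[ℂ] H, (∀ j, IsStrictlyPositive (B j)) →
        harmMean ω B ≤ 𝔐.mean H B ∧ 𝔐.mean H B ≤ arithMean ω B)
    {A : Fin n → H →L[ℂ] H} (hA : ∀ j, IsStrictlyPositive (A j)) {X : H →L[ℂ] H}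
    (hX : IsStrictlyPositive X) (hfix : X = 𝔐.mean H (fun j => σ.op H X (A j))) :
    X ≤ ∑ j, ω j • A j ∧ Ring.inverse X ≤ ∑ j, ω j • Ring.inverse (A j) := by
  obtain ⟨α, hα, h⟩ := σ.exists_weight hσ
  have hsp : ∀ j, IsStrictlyPositive (σ.op H X (A j)) := fun j => σ.isStrictlyPositive_op hX (hA j)
  obtain ⟨h1, h2⟩ := h𝔐 (fun j => σ.op H X (A j)) hsp
  rw [← hfix] at h1 h2
  -- Averaging gives Y ≤ Y - α Y + α ∑ ω_j B_j; cancel Y and divide by α > 0. This serves once for X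
  -- and once for X⁻¹.
  have key : ∀ (Y : H →L[ℂ] H) (B C : Fin n → H →L[ℂ] H), Y ≤ ∑ j, ω j • C j →
      (∀ j, C j ≤ (1 - α) • Y + α • B j) → Y ≤ ∑ j, ω j • B j := by
    intro Y B C hY hC
    have h3 : ∑ j, ω j • C j ≤ ∑ j, ω j • ((1 - α) • Y + α • B j) :=
      Finset.sum_le_sum fun j _ => smul_le_smul_of_nonneg_left (hC j) (hω j)
    have h4 : ∑ j, ω j • ((1 - α) • Y + α • B j) = Y - α • Y + α • ∑ j, ω j • B j := by
      simp only [smul_add, Finset.sum_add_distrib]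
      rw [← Finset.sum_smul, hω_sum, one_smul, sub_smul, one_smul, Finset.smul_sum]
      congr 1
      exact Finset.sum_congr rfl fun j _ => smul_comm _ _ _
    have h5 := hY.trans h3
    rw [h4] at h5
    have h6 : α • Y ≤ α • ∑ j, ω j • B j := by
      have := sub_nonneg.2 h5
      rw [← sub_nonneg]
      convert this using 1
      abel
    have h7 := smul_le_smul_of_nonneg_left h6 (inv_pos.2 hα).le
    rwa [smul_smul, smul_smul, inv_mul_cancel₀ hα.ne', one_smul, one_smul] at h7
  refine ⟨key X A _ h2 fun j => (h H X (A j) hX (hA j)).1,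
    key _ _ (fun j => Ring.inverse (σ.op H X (A j))) ?_ fun j => (h H X (A j) hX (hA j)).2⟩
  have hsum := sum_smul_strictlyPositive hω hω_sum fun j => (hsp j).ringInverse
  have h3 := CStarAlgebra.ringInverse_le_ringInverse h1 hsum.ringInverse
  rwa [harmMean, Ring.inverse_inverse hsum.isUnit] at h3

/-- The deformed mean lies between the weighted harmonic and arithmetic means. -/
lemma deformedMean_bounds (hσ : ¬ σ.IsLeftTrivial) {ω : Fin n → ℝ}
    (hω : ∀ j, 0 ≤ ω j) (hω_sum : ∑ j, ω j = 1)
    (h𝔐 : ∀ B : Fin n → H →L[ℂ] H, (∀ j, IsStrictlyPositive (B j)) →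
        harmMean ω B ≤ 𝔐.mean H B ∧ 𝔐.mean H B ≤ arithMean ω B)
    {A : Fin n → H →L[ℂ] H} {m M : ℝ} (hm : 0 < m) (hmM : m ≤ M)
    (hAm : ∀ j, m • (1 : H →L[ℂ] H) ≤ A j) (hAM : ∀ j, A j ≤ M • (1 : H →L[ℂ] H)) :
    IsStrictlyPositive (deformedMean 𝔐 σ A) ∧ deformedMean 𝔐 σ A ≤ ∑ j, ω j • A j ∧
      Ring.inverse (deformedMean 𝔐 σ A) ≤ ∑ j, ω j • Ring.inverse (A j) := by
  have hex := exists_deformedMean 𝔐 σ hm hmM hAm hAM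
  have hdef : deformedMean 𝔐 σ A = hex.choose := dif_pos hex
  rw [hdef]
  exact ⟨hex.choose_spec.1, le_and_ringInverse_le_of_fixedPoint 𝔐 σ hσ hω hω_sum h𝔐
    (fun j => isStrictlyPositive_of_smul_one_le hm (hAm j)) hex.choose_spec.1 hex.choose_spec.2⟩

end Deformed

/-! ### Scalar inequalities: chords, Kantorovich constants and γ -/

section Scalar

/-- Bernoulli's inequality; for p ≤ -1 it is applied to x⁻¹ with exponent -p, and x + x⁻¹ ≥ 2
returns to x. -/
lemma one_add_mul_sub_one_le_rpow {p : ℝ} (hp : 1 ≤ p ∨ p ≤ -1) {x : ℝ} (hx : 0 < x) :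
    1 + p * (x - 1) ≤ x ^ p := by
  rcases hp with hp | hp
  · have h := one_add_mul_self_le_rpow_one_add (s := x - 1) (by linarith) hp
    rwa [add_sub_cancel] at h
  · have hx' := inv_pos.2 hx
    have h := one_add_mul_self_le_rpow_one_add (s := x⁻¹ - 1) (by linarith) (p := -p) (by linarith)
    rw [add_sub_cancel, Real.inv_rpow hx.le, Real.rpow_neg hx.le, inv_inv] at h
    have h2 : 0 ≤ (x - 1) + (x⁻¹ - 1) := by
      have : (x - 1) + (x⁻¹ - 1) = (x - 1) ^ 2 * x⁻¹ := by field_simp; ring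
      rw [this]; positivity
    nlinarith

lemma rpow_tangent_le {p : ℝ} (hp : 1 ≤ p ∨ p ≤ -1) {x y : ℝ} (hx : 0 < x) (hy : 0 < y) :
    y ^ p + p * y ^ (p - 1) * (x - y) ≤ x ^ p := by
  have h := one_add_mul_sub_one_le_rpow hp (div_pos hx hy)
  have hyp : 0 < y ^ p := Real.rpow_pos_of_pos hy p
  rw [Real.div_rpow hx.le hy.le, le_div_iff₀ hyp] at h
  rw [Real.rpow_sub_one hy.ne']
  refine le_trans (le_of_eq ?_) h
  field_simp

/-- Slope of the chord of `t ↦ t ^ p` over `[m, M]`. -/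
noncomputable def chordSlope (m M p : ℝ) : ℝ := (M ^ p - m ^ p) / (M - m)

/-- Intercept of the chord of `t ↦ t ^ p` over `[m, M]`. -/
noncomputable def chordIntercept (m M p : ℝ) : ℝ := (M * m ^ p - m * M ^ p) / (M - m)

variable {m M p : ℝ}

lemma chord_left (hmM : m < M) : chordSlope m M p * m + chordIntercept m M p = m ^ p := by
  have : M - m ≠ 0 := (sub_pos.2 hmM).ne'
  unfold chordSlope chordIntercept
  field_simp
  ring

lemma chord_right (hmM : m < M) : chordSlope m M p * M + chordIntercept m M p = M ^ p := by
  have : M - m ≠ 0 := (sub_pos.2 hmM).ne'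
  unfold chordSlope chordIntercept
  field_simp
  ring

lemma rpow_le_chord (hp : 1 ≤ p ∨ p ≤ -1) (hm : 0 < m) (hmM : m < M) {t : ℝ} (hmt : m ≤ t)
    (htM : t ≤ M) : t ^ p ≤ chordSlope m M p * t + chordIntercept m M p := by
  have ht : 0 < t := hm.trans_le hmt
  have hd : 0 < M - m := sub_pos.2 hmM
  -- The tangent at t is evaluated at m and M with weights M - t and t - m; the derivative terms
  -- cancel.
  have h1 := mul_le_mul_of_nonneg_left (rpow_tangent_le hp hm ht) (sub_nonneg.2 htM)
  have h2 := mul_le_mul_of_nonneg_left (rpow_tangent_le hp (hm.trans hmM) ht) (sub_nonneg.2 hmt)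
  have h3 : chordSlope m M p * t + chordIntercept m M p
      = ((M - t) * m ^ p + (t - m) * M ^ p) / (M - m) := by
    unfold chordSlope chordIntercept
    field_simp
    ring
  rw [h3, le_div_iff₀ hd]
  nlinarith

lemma chordSlope_nonneg (hp : 0 ≤ p) (hm : 0 < m) (hmM : m < M) : 0 ≤ chordSlope m M p :=
  div_nonneg (sub_nonneg.2 (Real.rpow_le_rpow hm.le hmM.le hp)) (sub_pos.2 hmM).le

lemma chordSlope_neg (hp : p < 0) (hm : 0 < m) (hmM : m < M) : chordSlope m M p < 0 :=
  div_neg_of_neg_of_pos (sub_neg.2 (Real.rpow_lt_rpow_of_neg hm hmM hp)) (sub_pos.2 hmM)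

/-- With K = c s^p, the chord is c m^p times the tangent at 1 of x ↦ x^p, taken at x = s t / m. So
the bound holds for all t > 0, not only on [m, M]. -/
lemma chord_le_kantorovich_mul (hp : 1 ≤ p ∨ p ≤ -1) (hm : 0 < m) (hmM : m < M) {t : ℝ}
    (ht : 0 < t) :
    chordSlope m M p * t + chordIntercept m M p ≤ kantorovich (M / m) p * t ^ p := by
  have hh : 1 < M / m := (one_lt_div hm).2 hmM
  by_cases hp1 : p = 1
  · subst hp1
    have : M - m ≠ 0 := (sub_pos.2 hmM).ne'
    simp only [chordSlope, chordIntercept, kantorovich, Real.rpow_one, or_true, true_or, if_true]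
    rw [div_self this, mul_comm m M, sub_self, zero_div, add_zero]
  have hp0 : p ≠ 0 := by rcases hp with h | h <;> linarith
  have hp1' : p - 1 ≠ 0 := sub_ne_zero.2 hp1
  rw [kantorovich, if_neg (by simp [hp0, hp1, hh.ne'])]
  obtain ⟨h, hhdef⟩ : ∃ h, h = M / m := ⟨_, rfl⟩
  have hM : M = h * m := by rw [hhdef]; field_simp
  rw [← hhdef] at hh ⊢
  have h0 : 0 < h := by linarith
  have hh1 : h - 1 ≠ 0 := by linarith
  have hMp : M ^ p = h ^ p * m ^ p := by rw [hM, Real.mul_rpow h0.le hm.le]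
  have hmp : 0 < m ^ p := Real.rpow_pos_of_pos hm p
  -- In both ranges of p these signs make s and c positive.
  have hsgn : (1 < p ∧ h < h ^ p) ∨ (p < 0 ∧ h ^ p < 1) := by
    rcases hp with h1 | h1
    · left
      have h2 : 1 < p := lt_of_le_of_ne h1 (Ne.symm hp1)
      exact ⟨h2, by simpa using Real.rpow_lt_rpow_of_exponent_lt hh h2⟩
    · right
      have h2 : p < 0 := by linarith
      exact ⟨h2, Real.rpow_lt_one_of_one_lt_of_neg hh h2⟩
  obtain ⟨s, hs⟩ : ∃ s, s = (p - 1) / p * ((h ^ p - 1) / (h ^ p - h)) := ⟨_, rfl⟩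
  obtain ⟨c, hc⟩ : ∃ c, c = (h ^ p - h) / ((p - 1) * (h - 1)) := ⟨_, rfl⟩
  have hne : h ^ p - h ≠ 0 := by rcases hsgn with ⟨_, h1⟩ | ⟨_, h1⟩ <;> linarith
  have hs0 : 0 < s := by
    rw [hs]
    rcases hsgn with ⟨h1, h2⟩ | ⟨h1, h2⟩
    · exact mul_pos (div_pos (by linarith) (by linarith)) (div_pos (by linarith) (by linarith))
    · exact mul_pos (div_pos_of_neg_of_neg (by linarith) h1)
        (div_pos_of_neg_of_neg (by linarith) (by linarith))
  have hc0 : 0 < c := by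
    rw [hc]
    rcases hsgn with ⟨h1, h2⟩ | ⟨h1, h2⟩
    · exact div_pos (by linarith) (mul_pos (by linarith) (by linarith))
    · exact div_pos_of_neg_of_neg (by linarith) (mul_neg_of_neg_of_pos (by linarith) (by linarith))
  rw [← hs, ← hc]
  have key := one_add_mul_sub_one_le_rpow hp (x := s * t / m) (by positivity)
  rw [Real.div_rpow (by positivity) hm.le, Real.mul_rpow hs0.le ht.le, le_div_iff₀ hmp] at key
  have key2 := mul_le_mul_of_nonneg_left key hc0.le
  have e1 : c * (p * s) = (h ^ p - 1) / (h - 1) := by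
    rw [hc, hs]; field_simp
  have e2 : c * (1 - p) = (h - h ^ p) / (h - 1) := by
    rw [hc]; field_simp; ring
  have e3 : chordSlope m M p = (h ^ p - 1) / (h - 1) * m ^ p / m := by
    rw [chordSlope, hMp, hM, show h * m - m = (h - 1) * m by ring]; field_simp
  have e4 : chordIntercept m M p = (h - h ^ p) / (h - 1) * m ^ p := by
    rw [chordIntercept, hMp, hM, show h * m - m = (h - 1) * m by ring]; field_simp
  rw [e3, e4, ← e1, ← e2]
  refine le_trans (le_of_eq ?_) (key2.trans (le_of_eq ?_))
  · field_simp; ring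
  · ring

/-- At t = m the chord meets the power. -/
lemma one_le_kantorovich (hp : 1 ≤ p ∨ p ≤ -1) (hm : 0 < m) (hmM : m < M) :
    1 ≤ kantorovich (M / m) p := by
  have h := chord_le_kantorovich_mul hp hm hmM hm
  rw [chord_left hmM] at h
  have hmp : 0 < m ^ p := Real.rpow_pos_of_pos hm p
  exact le_of_mul_le_mul_right (by rwa [one_mul]) hmp

lemma kantorovich_neg_one {a b : ℝ} (ha : 0 < a) (hab : a < b) :
    kantorovich (b / a) (-1) = (b + a) ^ 2 / (4 * b * a) := by
  have hh : 1 < b / a := (one_lt_div ha).2 hab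
  rw [kantorovich, if_neg (by norm_num; exact hh.ne')]
  have hb : 0 < b := ha.trans hab
  have h1 : b - a ≠ 0 := (sub_pos.2 hab).ne'
  rw [Real.rpow_neg_one, Real.rpow_neg_one]
  have e1 : (b / a)⁻¹ - b / a = -((b - a) * (b + a)) / (a * b) := by field_simp; ring
  have e2 : (b / a)⁻¹ - 1 = -(b - a) / b := by field_simp; ring
  have e3 : b / a - 1 = (b - a) / a := by field_simp
  rw [e1, e2, e3]
  have : b + a ≠ 0 := by positivity
  field_simp
  ring

/-- The function chord(t) - α t^p is concave with critical point `gammaPoint`; γ is its maximum on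
[m, M], with one case for an interior maximum and one for each endpoint. The proof uses the tangent
to α t^p at the maximizer. -/
lemma chord_le_add_gammaConst (hp : p ≤ -1) (hm : 0 < m) (hmM : m < M) {α : ℝ} (hα : 0 < α)
    {t : ℝ} (hmt : m ≤ t) (htM : t ≤ M) :
    chordSlope m M p * t + chordIntercept m M p ≤ α * t ^ p + gammaConst m M p α := by
  have hp0 : p < 0 := by linarith
  have ht : 0 < t := hm.trans_le hmt
  have hM : 0 < M := hm.trans hmM
  have hd : 0 < M - m := sub_pos.2 hmM
  have hslope := chordSlope_neg hp0 hm hmM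
  -- The critical point s satisfies s^(p-1) = q, that is, α p s^(p-1) is the chord slope.
  obtain ⟨q, hq⟩ : ∃ q, q = (M ^ p - m ^ p) / (α * p * (M - m)) := ⟨_, rfl⟩
  have hqs : chordSlope m M p = α * p * q := by
    have := hp0.ne
    rw [chordSlope, hq]; field_simp
  have hq0 : 0 < q := by
    have : α * p < 0 := mul_neg_of_pos_of_neg hα hp0
    by_contra hneg
    push Not at hneg
    have := mul_nonneg_of_nonpos_of_nonpos this.le hneg
    linarith
  have hp1 : p - 1 ≠ 0 := by linarith
  obtain ⟨s, hs⟩ : ∃ s, s = q ^ (1 / (p - 1)) := ⟨_, rfl⟩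
  have hs0 : 0 < s := by rw [hs]; exact Real.rpow_pos_of_pos hq0 _
  have hsp1 : s ^ (p - 1) = q := by
    rw [hs, ← Real.rpow_mul hq0.le, one_div, inv_mul_cancel₀ hp1, Real.rpow_one]
  have hsp : s ^ p = q ^ (p / (p - 1)) := by
    rw [hs, ← Real.rpow_mul hq0.le]; congr 1; ring
  have tangent : ∀ y, 0 < y → α * (y ^ p + p * y ^ (p - 1) * (t - y)) ≤ α * t ^ p :=
    fun y hy => mul_le_mul_of_nonneg_left (rpow_tangent_le (Or.inr hp) ht hy) hα.le
  have hαp : α * p ≤ 0 := (mul_neg_of_pos_of_neg hα hp0).le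
  rw [gammaConst, gammaPoint, ← hq, ← hs, ← hsp]
  change _ ≤ α * t ^ p + if m ≤ s ∧ s ≤ M then α * (p - 1) * s ^ p + chordIntercept m M p
    else if M ≤ s then (1 - α) * M ^ p else (1 - α) * m ^ p
  split_ifs with h1 h2
  · have h := tangent s hs0
    have e : s ^ p = s ^ (p - 1) * s := by rw [Real.rpow_sub_one hs0.ne']; field_simp
    rw [hsp1] at h e
    rw [hqs]
    rw [e] at h ⊢
    nlinarith
  · have h := tangent M hM
    have h3 : q ≤ M ^ (p - 1) := by
      rw [← hsp1]; exact Real.rpow_le_rpow_of_nonpos hM h2 (by linarith)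
    have h4 := chord_right (p := p) hmM
    have h5 := mul_nonneg_of_nonpos_of_nonpos
      (mul_nonpos_of_nonpos_of_nonneg hαp (sub_nonneg.2 h3)) (sub_nonpos.2 htM)
    rw [hqs] at h4 ⊢
    nlinarith
  · have hsm : s ≤ m := by
      by_contra hneg
      push Not at hneg h2
      exact h1 ⟨hneg.le, h2.le⟩
    have h := tangent m hm
    have h3 : m ^ (p - 1) ≤ q := by
      rw [← hsp1]; exact Real.rpow_le_rpow_of_nonpos hs0 hsm (by linarith)
    have h4 := chord_left (p := p) hmM
    have h5 := mul_nonneg_of_nonpos_of_nonpos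
      (mul_nonpos_of_nonpos_of_nonneg hαp (sub_nonneg.2 hmt)) (sub_nonpos.2 h3)
    rw [hqs] at h4 ⊢
    nlinarith

end Scalar

/-! ### Chord estimates for operators and weighted families -/

section OperatorChord

variable {H : Type u} [NormedAddCommGroup H] [InnerProductSpace ℂ H] [CompleteSpace H]
  {S : H →L[ℂ] H} {m M p : ℝ}

lemma spectrum_bounds (hS : IsSelfAdjoint S) (hmS : m • (1 : H →L[ℂ] H) ≤ S)
    (hSM : S ≤ M • (1 : H →L[ℂ] H)) {t : ℝ} (ht : t ∈ spectrum ℝ S) : m ≤ t ∧ t ≤ M := by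
  rw [← Algebra.algebraMap_eq_smul_one] at hmS hSM
  exact ⟨(algebraMap_le_iff_le_spectrum hS).1 hmS t ht,
    (le_algebraMap_iff_spectrum_le hS).1 hSM t ht⟩

lemma smul_add_smul_one_eq_cfc (hS : IsSelfAdjoint S) (a b : ℝ) :
    a • S + b • (1 : H →L[ℂ] H) = cfc (fun t : ℝ => a * t + b) S := by
  rw [cfc_add_const b (fun t : ℝ => a * t) S, cfc_const_mul_id a S,
    Algebra.algebraMap_eq_smul_one]

lemma smul_rpow_add_smul_one_eq_cfc (hS : IsStrictlyPositive S) (a b : ℝ) :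
    a • S ^ p + b • (1 : H →L[ℂ] H) = cfc (fun t : ℝ => a * t ^ p + b) S := by
  have hc : ContinuousOn (fun t : ℝ => t ^ p) (spectrum ℝ S) :=
    continuousOn_id.rpow_const fun t ht => Or.inl (hS.spectrum_pos ht).ne'
  have hsa := hS.isSelfAdjoint
  rw [cfc_add_const b (fun t : ℝ => a * t ^ p) S (continuousOn_const.mul hc),
    cfc_const_mul a (fun t : ℝ => t ^ p) S hc,
    Algebra.algebraMap_eq_smul_one, CFC.rpow_eq_cfc_real hS.nonneg]

lemma rpow_le_affine (hS : IsStrictlyPositive S) (a b : ℝ)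
    (h : ∀ t ∈ spectrum ℝ S, t ^ p ≤ a * t + b) : S ^ p ≤ a • S + b • (1 : H →L[ℂ] H) := by
  have hc : ContinuousOn (fun t : ℝ => t ^ p) (spectrum ℝ S) :=
    continuousOn_id.rpow_const fun t ht => Or.inl (hS.spectrum_pos ht).ne'
  rw [smul_add_smul_one_eq_cfc hS.isSelfAdjoint, CFC.rpow_eq_cfc_real hS.nonneg]
  exact cfc_mono h hc (by fun_prop)

lemma affine_le_rpow (hS : IsStrictlyPositive S) (a b c d : ℝ)
    (h : ∀ t ∈ spectrum ℝ S, a * t + b ≤ c * t ^ p + d) :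
    a • S + b • (1 : H →L[ℂ] H) ≤ c • S ^ p + d • (1 : H →L[ℂ] H) := by
  have hc : ContinuousOn (fun t : ℝ => t ^ p) (spectrum ℝ S) :=
    continuousOn_id.rpow_const fun t ht => Or.inl (hS.spectrum_pos ht).ne'
  rw [smul_add_smul_one_eq_cfc hS.isSelfAdjoint, smul_rpow_add_smul_one_eq_cfc hS]
  exact cfc_mono h (by fun_prop) ((continuousOn_const.mul hc).add continuousOn_const)

lemma rpow_le_chord_operator (hp : 1 ≤ p ∨ p ≤ -1) (hm : 0 < m) (hmM : m < M)
    (hmS : m • (1 : H →L[ℂ] H) ≤ S) (hSM : S ≤ M • (1 : H →L[ℂ] H)) :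
    S ^ p ≤ chordSlope m M p • S + chordIntercept m M p • (1 : H →L[ℂ] H) := by
  have hS := isStrictlyPositive_of_smul_one_le hm hmS
  refine rpow_le_affine hS _ _ fun t ht => ?_
  obtain ⟨h1, h2⟩ := spectrum_bounds hS.isSelfAdjoint hmS hSM ht
  exact rpow_le_chord hp hm hmM h1 h2

lemma chord_operator_le_kantorovich (hp : 1 ≤ p ∨ p ≤ -1) (hm : 0 < m) (hmM : m < M)
    (hS : IsStrictlyPositive S) :
    chordSlope m M p • S + chordIntercept m M p • (1 : H →L[ℂ] H)
      ≤ kantorovich (M / m) p • S ^ p := by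
  have h := affine_le_rpow (p := p) hS (chordSlope m M p) (chordIntercept m M p)
    (kantorovich (M / m) p) 0 fun t ht => by
      simpa using chord_le_kantorovich_mul hp hm hmM (hS.spectrum_pos ht)
  simpa using h

lemma rpow_bounds (hp : 0 ≤ p) (hm : 0 < m)
    (hmS : m • (1 : H →L[ℂ] H) ≤ S) (hSM : S ≤ M • (1 : H →L[ℂ] H)) :
    m ^ p • (1 : H →L[ℂ] H) ≤ S ^ p ∧ S ^ p ≤ M ^ p • (1 : H →L[ℂ] H) := by
  have hS := isStrictlyPositive_of_smul_one_le hm hmS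
  constructor
  · have h := affine_le_rpow (p := p) hS 0 (m ^ p) 1 0 fun t ht => by
      simpa using Real.rpow_le_rpow hm.le (spectrum_bounds hS.isSelfAdjoint hmS hSM ht).1 hp
    simpa using h
  · have h := rpow_le_affine (p := p) hS 0 (M ^ p) fun t ht => by
      simpa using Real.rpow_le_rpow (hS.spectrum_pos ht).le
        (spectrum_bounds hS.isSelfAdjoint hmS hSM ht).2 hp
    simpa using h

lemma ringInverse_rpow_neg (hS : IsStrictlyPositive S) {r : ℝ} :
    Ring.inverse S ^ (-r) = S ^ r := by
  rw [CFC.inverse_eq_rpow_neg_one hS, CFC.rpow_rpow S (-1) (-r) (by norm_num) hS]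
  congr 1
  ring

omit [CompleteSpace H] in
lemma ringInverse_smul_one {c : ℝ} (hc : 0 < c) :
    Ring.inverse (c • (1 : H →L[ℂ] H)) = c⁻¹ • (1 : H →L[ℂ] H) := by
  apply Ring.inverse_eq_of_mul_eq_one
  · rw [smul_mul_smul_comm, mul_one, mul_inv_cancel₀ hc.ne', one_smul]
  · rw [smul_mul_smul_comm, mul_one, inv_mul_cancel₀ hc.ne', one_smul]

lemma ringInverse_bounds (hm : 0 < m) (hM : 0 < M) (hmS : m • (1 : H →L[ℂ] H) ≤ S)
    (hSM : S ≤ M • (1 : H →L[ℂ] H)) :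
    (1 / M) • (1 : H →L[ℂ] H) ≤ Ring.inverse S ∧ Ring.inverse S ≤ (1 / m) • (1 : H →L[ℂ] H) := by
  have hS := isStrictlyPositive_of_smul_one_le hm hmS
  have h1 := CStarAlgebra.ringInverse_le_ringInverse hSM hS
  have h2 := CStarAlgebra.ringInverse_le_ringInverse hmS (isStrictlyPositive_smul_one hm)
  rw [ringInverse_smul_one hM] at h1
  rw [ringInverse_smul_one hm] at h2
  rw [one_div, one_div]
  exact ⟨h1, h2⟩

section Family

variable {n : ℕ} {ω : Fin n → ℝ} {A : Fin n → H →L[ℂ] H} {X : H →L[ℂ] H} {r : ℝ}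

omit [CompleteSpace H] in
lemma sum_smul_affine (hω_sum : ∑ j, ω j = 1) (B : Fin n → H →L[ℂ] H) (a b : ℝ) :
    ∑ j, ω j • (a • B j + b • (1 : H →L[ℂ] H)) = a • (∑ j, ω j • B j) + b • (1 : H →L[ℂ] H) := by
  simp only [smul_add, Finset.sum_add_distrib]
  rw [← Finset.sum_smul, hω_sum, one_smul, Finset.smul_sum]
  congr 1
  exact Finset.sum_congr rfl fun j _ => smul_comm _ _ _

lemma sum_smul_le_smul_one (hω : ∀ j, 0 ≤ ω j) (hω_sum : ∑ j, ω j = 1)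
    {B : Fin n → H →L[ℂ] H} {c : ℝ} (hB : ∀ j, B j ≤ c • (1 : H →L[ℂ] H)) :
    ∑ j, ω j • B j ≤ c • (1 : H →L[ℂ] H) := by
  have h : ∑ j, ω j • B j ≤ ∑ j, ω j • (c • (1 : H →L[ℂ] H)) :=
    Finset.sum_le_sum fun j _ => smul_le_smul_of_nonneg_left (hB j) (hω j)
  rwa [← Finset.sum_smul, hω_sum, one_smul] at h

/-- The upper half of the Mond–Pečarić estimate: an operator above the weighted harmonic mean has
its `r`-th power bounded below through the chord of `t ↦ t ^ (-r)`. -/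
lemma sum_rpow_le_chord_ringInverse (hω : ∀ j, 0 ≤ ω j) (hω_sum : ∑ j, ω j = 1)
    (hm : 0 < m) (hmM : m < M) (hr : 1 ≤ r)
    (hAm : ∀ j, m • (1 : H →L[ℂ] H) ≤ A j) (hAM : ∀ j, A j ≤ M • (1 : H →L[ℂ] H))
    (hX : Ring.inverse X ≤ ∑ j, ω j • Ring.inverse (A j)) :
    ∑ j, ω j • A j ^ r ≤ chordSlope (1 / M) (1 / m) (-r) • Ring.inverse X
      + chordIntercept (1 / M) (1 / m) (-r) • (1 : H →L[ℂ] H) := by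
  have hM : 0 < M := hm.trans hmM
  have hlt : 1 / M < 1 / m := one_div_lt_one_div_of_lt hm hmM
  have hM' : 0 < 1 / M := one_div_pos.2 hM
  have h1 : ∀ j, A j ^ r ≤ chordSlope (1 / M) (1 / m) (-r) • Ring.inverse (A j)
      + chordIntercept (1 / M) (1 / m) (-r) • (1 : H →L[ℂ] H) := by
    intro j
    have hb := ringInverse_bounds hm hM (hAm j) (hAM j)
    have h := rpow_le_chord_operator (p := -r) (Or.inr (by linarith)) hM' hlt hb.1 hb.2
    rwa [ringInverse_rpow_neg (isStrictlyPositive_of_smul_one_le hm (hAm j))] at h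
  have h2 := Finset.sum_le_sum fun j (_ : j ∈ Finset.univ) =>
    smul_le_smul_of_nonneg_left (h1 j) (hω j)
  rw [sum_smul_affine hω_sum] at h2
  refine h2.trans (add_le_add_left ?_ _)
  exact smul_le_smul_of_nonpos_left hX (chordSlope_neg (by linarith) hM' hlt).le

lemma sum_rpow_le_kantorovich_smul (hω : ∀ j, 0 ≤ ω j) (hω_sum : ∑ j, ω j = 1)
    (hm : 0 < m) (hmM : m < M) (hr : 1 ≤ r)
    (hAm : ∀ j, m • (1 : H →L[ℂ] H) ≤ A j) (hAM : ∀ j, A j ≤ M • (1 : H →L[ℂ] H))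
    (hXsp : IsStrictlyPositive X) (hX : Ring.inverse X ≤ ∑ j, ω j • Ring.inverse (A j)) :
    ∑ j, ω j • A j ^ r ≤ kantorovich (M / m) (-r) • X ^ r := by
  have h := (sum_rpow_le_chord_ringInverse hω hω_sum hm hmM hr hAm hAM hX).trans
    (chord_operator_le_kantorovich (p := -r) (Or.inr (by linarith))
      (one_div_pos.2 (hm.trans hmM)) (one_div_lt_one_div_of_lt hm hmM) hXsp.ringInverse)
  rwa [ringInverse_rpow_neg hXsp, show 1 / m / (1 / M) = M / m by field_simp] at h

/-- Unlike the Kantorovich bound, γ controls the chord only on [1/M, 1/m], so the spectrum of X⁻¹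
must be located there; this is where X ≤ ∑ ω_j A_j enters. -/
lemma sum_rpow_le_smul_add_gammaConst (hω : ∀ j, 0 ≤ ω j) (hω_sum : ∑ j, ω j = 1)
    (hm : 0 < m) (hmM : m < M) (hr : 1 ≤ r)
    (hAm : ∀ j, m • (1 : H →L[ℂ] H) ≤ A j) (hAM : ∀ j, A j ≤ M • (1 : H →L[ℂ] H))
    (hXsp : IsStrictlyPositive X) (hXA : X ≤ ∑ j, ω j • A j)
    (hX : Ring.inverse X ≤ ∑ j, ω j • Ring.inverse (A j)) {α : ℝ} (hα : 0 < α) :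
    ∑ j, ω j • A j ^ r
      ≤ α • X ^ r + gammaConst (1 / M) (1 / m) (-r) α • (1 : H →L[ℂ] H) := by
  have hM : 0 < M := hm.trans hmM
  refine (sum_rpow_le_chord_ringInverse hω hω_sum hm hmM hr hAm hAM hX).trans ?_
  rw [← ringInverse_rpow_neg hXsp]
  have h1 : Ring.inverse X ≤ (1 / m) • (1 : H →L[ℂ] H) := hX.trans
    (sum_smul_le_smul_one hω hω_sum fun j => (ringInverse_bounds hm hM (hAm j) (hAM j)).2)
  have h2 : (1 / M) • (1 : H →L[ℂ] H) ≤ Ring.inverse X := by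
    have h := CStarAlgebra.ringInverse_le_ringInverse
      (hXA.trans (sum_smul_le_smul_one hω hω_sum hAM)) hXsp
    rwa [ringInverse_smul_one hM, ← one_div] at h
  refine affine_le_rpow hXsp.ringInverse _ _ _ _ fun t ht => ?_
  obtain ⟨h3, h4⟩ := spectrum_bounds hXsp.ringInverse.isSelfAdjoint h2 h1 ht
  exact chord_le_add_gammaConst (by linarith) (one_div_pos.2 hM)
    (one_div_lt_one_div_of_lt hm hmM) hα h3 h4

/-- The power t^r need not be operator monotone, but its chord is affine with nonnegative slope: X
may be replaced by ∑ ω_j A_j inside the chord, which is then compared with A_j^r term by term. -/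
lemma rpow_le_kantorovich_smul_sum (hω : ∀ j, 0 ≤ ω j) (hω_sum : ∑ j, ω j = 1)
    (hm : 0 < m) (hmM : m < M) (hr : 1 ≤ r)
    (hAm : ∀ j, m • (1 : H →L[ℂ] H) ≤ A j) (hAM : ∀ j, A j ≤ M • (1 : H →L[ℂ] H))
    (hXsp : IsStrictlyPositive X) (hXA : X ≤ ∑ j, ω j • A j)
    (hX : Ring.inverse X ≤ ∑ j, ω j • Ring.inverse (A j)) :
    X ^ r ≤ kantorovich (M / m) r • ∑ j, ω j • A j ^ r := by
  have hM : 0 < M := hm.trans hmM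
  have hXM : X ≤ M • (1 : H →L[ℂ] H) := hXA.trans (sum_smul_le_smul_one hω hω_sum hAM)
  have hmX : m • (1 : H →L[ℂ] H) ≤ X := by
    have h1 : Ring.inverse X ≤ (1 / m) • (1 : H →L[ℂ] H) := hX.trans
      (sum_smul_le_smul_one hω hω_sum fun j => (ringInverse_bounds hm hM (hAm j) (hAM j)).2)
    have h := CStarAlgebra.ringInverse_le_ringInverse h1 hXsp.ringInverse
    rwa [ringInverse_smul_one (one_div_pos.2 hm), Ring.inverse_inverse hXsp.isUnit, one_div,
      inv_inv] at h
  refine (rpow_le_chord_operator (Or.inl hr) hm hmM hmX hXM).trans ?_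
  have h1 := smul_le_smul_of_nonneg_left hXA (chordSlope_nonneg (p := r) (by linarith) hm hmM)
  refine (add_le_add_left h1 _).trans ?_
  rw [← sum_smul_affine hω_sum, Finset.smul_sum]
  refine Finset.sum_le_sum fun j _ => ?_
  rw [smul_comm]
  exact smul_le_smul_of_nonneg_left (chord_operator_le_kantorovich (Or.inl hr) hm hmM
    (isStrictlyPositive_of_smul_one_le hm (hAm j))) (hω j)

end Family

end OperatorChord

/-! ### The three inequalities -/

theorem corollary3p6 {H K : Type u}
    [NormedAddCommGroup H] [InnerProductSpace ℂ H] [CompleteSpace H]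
    [NormedAddCommGroup K] [InnerProductSpace ℂ K] [CompleteSpace K]
    {n : ℕ} (𝔐 : OperatorMean.{u} n) (σ : KuboAndoMean.{u}) (hσ : ¬ σ.IsLeftTrivial)
    (ω : Fin n → ℝ) (hω : ∀ j, 0 ≤ ω j) (hω_sum : ∑ j, ω j = 1)
    (h𝔐 : ∀ (L : Type u) [NormedAddCommGroup L] [InnerProductSpace ℂ L] [CompleteSpace L]
      (B : Fin n → L →L[ℂ] L), (∀ j, IsStrictlyPositive (B j)) →
        harmMean ω B ≤ 𝔐.mean L B ∧ 𝔐.mean L B ≤ arithMean ω B)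
    (Φ : (H →L[ℂ] H) →ₚ[ℂ] (K →L[ℂ] K)) (hΦ : Φ 1 = 1)
    (A : Fin n → H →L[ℂ] H) (hA : ∀ j, IsStrictlyPositive (A j))
    (m M : ℝ) (hm : 0 < m) (hmM : m < M)
    (hAm : ∀ j, m • (1 : H →L[ℂ] H) ≤ A j) (hAM : ∀ j, A j ≤ M • (1 : H →L[ℂ] H))
    (r : ℝ) (hr : 1 ≤ r) :
    deformedMean 𝔐 σ (fun j => Φ (A j ^ r)) - Φ (deformedMean 𝔐 σ A ^ r)
        ≤ gammaConst (1 / M) (1 / m) (-r) (kantorovich (M / m) r)⁻¹ • (1 : K →L[ℂ] K) ∧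
      (((M ^ r + m ^ r) ^ 2 / (4 * M ^ r * m ^ r))⁻¹
          * (kantorovich (M / m) (-r))⁻¹ * (kantorovich (M / m) r)⁻¹)
            • Φ (deformedMean 𝔐 σ A ^ r)
        ≤ deformedMean 𝔐 σ (fun j => Φ (A j ^ r)) ∧
      deformedMean 𝔐 σ (fun j => Φ (A j ^ r))
        ≤ (kantorovich (M / m) (-r) * kantorovich (M / m) r)
            • Φ (deformedMean 𝔐 σ A ^ r) := by
  have hM : 0 < M := hm.trans hmM
  have hr0 : 0 < r := by linarith
  have hmr : 0 < m ^ r := Real.rpow_pos_of_pos hm r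
  have hmMr : m ^ r < M ^ r := Real.rpow_lt_rpow hm.le hmM hr0
  have hΦsmul : ∀ (c : ℝ) (T : H →L[ℂ] H), Φ (c • T) = c • Φ T := fun c T => by
    rw [← Complex.coe_smul, map_smul, Complex.coe_smul]
  have hΦmono : ∀ {S T : H →L[ℂ] H}, S ≤ T → Φ S ≤ Φ T := fun h => OrderHomClass.mono Φ h
  have hBm : ∀ j, m ^ r • (1 : K →L[ℂ] K) ≤ Φ (A j ^ r) := fun j => by
    have h := hΦmono (rpow_bounds hr0.le hm (hAm j) (hAM j)).1
    rwa [hΦsmul, hΦ] at h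
  have hBM : ∀ j, Φ (A j ^ r) ≤ M ^ r • (1 : K →L[ℂ] K) := fun j => by
    have h := hΦmono (rpow_bounds hr0.le hm (hAm j) (hAM j)).2
    rwa [hΦsmul, hΦ] at h
  obtain ⟨hX, hXA, hXinv⟩ := deformedMean_bounds 𝔐 σ hσ hω hω_sum (h𝔐 H) hm hmM.le hAm hAM
  obtain ⟨hY, hYB, hYinv⟩ := deformedMean_bounds 𝔐 σ hσ hω hω_sum (h𝔐 K) hmr hmMr.le hBm hBM
  set X := deformedMean 𝔐 σ A
  set Y := deformedMean 𝔐 σ (fun j => Φ (A j ^ r))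
  have hΦsum : Φ (∑ j, ω j • A j ^ r) = ∑ j, ω j • Φ (A j ^ r) := by
    rw [map_sum]
    exact Finset.sum_congr rfl fun j _ => hΦsmul _ _
  have hK1 : 1 ≤ kantorovich (M / m) r := one_le_kantorovich (Or.inl hr) hm hmM
  have hK2 : 1 ≤ kantorovich (M / m) (-r) := one_le_kantorovich (Or.inr (by linarith)) hm hmM
  have hΦX : 0 ≤ Φ (X ^ r) := by
    have h := hΦmono (CFC.rpow_nonneg (a := X) (y := r))
    rwa [map_zero] at h
  refine ⟨?_, ?_, ?_⟩
  · have h1 := hΦmono (sum_rpow_le_smul_add_gammaConst hω hω_sum hm hmM hr hAm hAM hX hXA hXinv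
      (inv_pos.2 (one_pos.trans_le hK1)))
    rw [map_add, hΦsmul, hΦsmul, hΦ, hΦsum] at h1
    have h2 : (kantorovich (M / m) r)⁻¹ • Φ (X ^ r) ≤ Φ (X ^ r) := by
      conv_rhs => rw [← one_smul ℝ (Φ (X ^ r))]
      exact smul_le_smul_of_nonneg_right (inv_le_one_of_one_le₀ hK1) hΦX
    rw [sub_le_iff_le_add']
    exact hYB.trans (h1.trans (add_le_add_left h2 _))
  · have h1 := hΦmono (rpow_le_kantorovich_smul_sum hω hω_sum hm hmM hr hAm hAM hX hXA hXinv)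
    rw [hΦsmul, hΦsum] at h1
    -- Exponent 1 for the operators Φ(A_j^r), which lie between m^r and M^r; the constant is K(h^r,
    -- -1).
    have h2 := sum_rpow_le_kantorovich_smul hω hω_sum hmr hmMr le_rfl hBm hBM hY hYinv
    rw [kantorovich_neg_one hmr hmMr, CFC.rpow_one Y hY.nonneg] at h2
    simp only [fun j => CFC.rpow_one (Φ (A j ^ r))
      (isStrictlyPositive_of_smul_one_le hmr (hBm j)).nonneg] at h2
    set c := (M ^ r + m ^ r) ^ 2 / (4 * M ^ r * m ^ r)
    have hc : 0 < c := by
      have := hmr.trans hmMr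
      positivity
    have hk : 0 < kantorovich (M / m) r := one_pos.trans_le hK1
    have h3 := h1.trans (smul_le_smul_of_nonneg_left h2 hk.le)
    -- The factor K(h,-r)⁻¹ ≤ 1 is only given away.
    have h4 : (c⁻¹ * (kantorovich (M / m) (-r))⁻¹ * (kantorovich (M / m) r)⁻¹) • Φ (X ^ r)
        ≤ (c⁻¹ * (kantorovich (M / m) r)⁻¹) • Φ (X ^ r) := by
      refine smul_le_smul_of_nonneg_right ?_ hΦX
      refine mul_le_mul_of_nonneg_right ?_ (inv_pos.2 hk).le
      exact mul_le_of_le_one_right (inv_pos.2 hc).le (inv_le_one_of_one_le₀ hK2)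
    have h5 := smul_le_smul_of_nonneg_left h3 (mul_pos (inv_pos.2 hc) (inv_pos.2 hk)).le
    refine h4.trans (h5.trans (le_of_eq ?_))
    rw [smul_smul, smul_smul, show c⁻¹ * (kantorovich (M / m) r)⁻¹ * kantorovich (M / m) r * c = 1
      by field_simp, one_smul]
  · have h1 := hΦmono (sum_rpow_le_kantorovich_smul hω hω_sum hm hmM hr hAm hAM hX hXinv)
    rw [hΦsmul, hΦsum] at h1
    refine hYB.trans (h1.trans (smul_le_smul_of_nonneg_right ?_ hΦX))
    exact le_mul_of_one_le_right (zero_le_one.trans hK2) hK1
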